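/- Let $p$ be an odd prime and let $n \ge 1$ be an integer. Write $C_{p^n-1}$ for the cyclic group of order $p^n-1$. Conventions. For a finite group $G$, an extension $R \subseteq S$ of commutative rings with $G$ acting on $S$ by ring automorphisms is Galois with group $G$ if $S^G = R$ and for every maximal ideal $\mathfrak m$ of $S$ and every $\sigma \in G\setminus\{1\}$ there is $s \in S$ with $\sigma s - s \notin \mathfrak m$; when $R = L$ is a field, $S$ is called a Galois $G$-algebra over $L$. A Galois extension $S/R$ with group $G$, where $R$ is an algebra over a field $K$, is a generic $G$-extension over $K$ if (i) $R$ is a localized polynomial ring over $K$, i.e. $R \cong K[t_1,\dots,t_d,1/g]$ as a $K$-algebra for some $d \ge 0$ and some nonzero polynomial $g$, and (ii) for every extension field $L$ of $K$ and every Galois $G$-algebra $M$ over $L$ there is a $K$-algebra homomorphism $\varphi : R \to L$ such that $S\otimes_\varphi L \cong M$ as $L$-algebras with $G$-action. (a) For every field $K$ of characteristic $p$ there exists a generic $C_{p^n-1}$-extension over $K$. (b) Over $\mathbb F_p$ such an extension is given by the Lang map of a torus, as follows. Choose a basis $b_1,\dots,b_n$ of $\mathbb F_{p^n}$ over $\mathbb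 F_p$ and let $T = \mathrm{Res}_{\mathbb F_{p^n}/\mathbb F_p}\mathbf G_m \subseteq \mathbf{GL}_n$, so that for every commutative $\mathbb F_p$-algebra $A$ the group $T(A)$ consists of the matrices, in this basis, of multiplication by the units of $A \otimes_{\mathbb F_p} \mathbb F_{p^n}$. Let $\mathbb F_p[T]$ be the coordinate ring of $T$, i.e. the $\mathbb F_p$-algebra of functions on $T(\overline{\mathbb F}_p)$ generated by the matrix entries and the inverse of the determinant, and let $U = (f_{ij}(x_1,\dots,x_n))$ be the matrix, with entries in $\mathbb F_p[x_1,\dots,x_n]$, of multiplication by the general element $x_1b_1+\dots+x_nb_n$. Then: 1. $T(\mathbb F_p) \cong C_{p^n-1}$. 2. $\det U \ne 0$, and there is an isomorphism of $\mathbb F_p$-algebras $\mathbb F_p[x_1,\dots,x_n,1/\det U] \cong \mathbb F_p[T]$ taking $f_{ij}$ to the $(i,j)$-th coordinate function on $T$ for all $i,j$; in particular, $\mathbb F_p[T]$ is a localized polynomial ring. 3. Let $X^{(p)}$ denote the matrix obtained from $X$ by raising each entry to the power $p$, let $\lambda : T \to T$, $\lambda(X) = X\,(X^{(p)})^{-1}$,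 be the Lang map, and let $\lambda^* : \mathbb F_p[T] \to \mathbb F_p[T]$, $f \mapsto f\circ\lambda$. With $T(\mathbb F_p)$ acting on $\mathbb F_p[T]$ by $(gf)(X) = f(Xg)$, the ring extension $\mathbb F_p[T]/\lambda^*\mathbb F_p[T]$ is a generic $T(\mathbb F_p)$-extension over $\mathbb F_p$. -/

import Mathlib

open scoped TensorProduct

universe u v w

noncomputable section

/-! ### Galois extensions of commutative rings and generic extensions -/

/-- `S / R` is a Galois extension of commutative rings with group `G`: the ring `R` embeds in `S`
as the ring of invariants `S ^ G`, and no `σ ≠ 1` acts trivially modulo a maximal ideal of `S`.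
For `R` a field, `S` is then called a Galois `G`-algebra over `R`. -/
structure IsGaloisExtension (G : Type*) [Group G] (R S : Type*) [CommRing R] [CommRing S]
    [Algebra R S] [MulSemiringAction G S] : Prop where
  injective : Function.Injective (algebraMap R S)
  invariant : ∀ s : S, (∀ σ : G, σ • s = s) ↔ s ∈ (algebraMap R S).range
  unramified : ∀ m : Ideal S, m.IsMaximal → ∀ σ : G, σ ≠ 1 → ∃ s : S, σ • s - s ∉ m

/-- `R` is a localized polynomial ring `K[t₁, …, t_d, 1/g]` over `K`, with `g ≠ 0`. -/
def IsLocalizedPolynomialRing (K R : Type*) [Field K] [CommRing R] [Algebra K R] : Prop :=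
  ∃ (d : ℕ) (g : MvPolynomial (Fin d) K), g ≠ 0 ∧ Nonempty (Localization.Away g ≃ₐ[K] R)

/-- `S / R` is a generic `G`-extension over the field `K`. -/
structure IsGenericExtension (K : Type*) [Field K] (G : Type*) [Group G]
    (R S : Type*) [CommRing R] [CommRing S] [Algebra K R] [Algebra R S]
    [MulSemiringAction G S] : Prop where
  isGalois : IsGaloisExtension G R S
  isLocalized : IsLocalizedPolynomialRing K R
  generic : ∀ (L : Type u) [Field L] [Algebra K L]
    (M : Type v) [CommRing M] [Algebra L M] [MulSemiringAction G M],
    IsGaloisExtension G L M →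
    ∃ φ : R →ₐ[K] L,
      letI : Algebra R L := φ.toRingHom.toAlgebra
      ∃ e : (L ⊗[R] S) ≃ₐ[L] M, ∀ (σ : G) (a : L) (s : S), e (a ⊗ₜ (σ • s)) = σ • e (a ⊗ₜ s)

/-- There exists a generic `G`-extension over the field `K`. -/
def HasGenericExtension (K : Type w) [Field K] (G : Type*) [Group G] : Prop :=
  ∃ (R S : Type w) (_ : CommRing R) (_ : CommRing S) (_ : Algebra K R) (_ : Algebra R S)
    (_ : MulSemiringAction G S), IsGenericExtension.{u, v} K G R S

/-! ### The torus `Res_{E/K} G_m` as a closed subgroup of `GL_n` -/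

section Torus

variable {K E : Type*} [Field K] [Field E] [Algebra K E] {n : ℕ} (b : Module.Basis (Fin n) K E)

/-- The group `T(A)` of `A`-points of `T = Res_{E/K} G_m ⊆ GL_n`, for a commutative `K`-algebra `A`:
the matrices, in the basis `b`, of multiplication by the units of `A ⊗_K E`. -/
def torusPoints (A : Type*) [CommRing A] [Algebra K A] : Subgroup (GL (Fin n) A) :=
  (Units.map (Algebra.leftMulMatrix (Algebra.TensorProduct.basis A b)).toMonoidHom).range

/-- The matrix `(f_ij(x₁, …, x_n))` of multiplication by the general element `∑ x_k b_k`. -/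
def genericMatrix : Matrix (Fin n) (Fin n) (MvPolynomial (Fin n) K) :=
  Matrix.of fun i j => ∑ k, MvPolynomial.C (Algebra.leftMulMatrix b (b k) i j) * MvPolynomial.X k

theorem leftMulMatrix_baseChange_map {A B : Type*} [CommRing A] [Algebra K A] [CommRing B]
    [Algebra K B] (f : A →ₐ[K] B) (z : A ⊗[K] E) :
    (Algebra.leftMulMatrix (Algebra.TensorProduct.basis A b) z).map f =
      Algebra.leftMulMatrix (Algebra.TensorProduct.basis B b)
        (Algebra.TensorProduct.map f (AlgHom.id K E) z) := by
  induction z using TensorProduct.induction_on with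
  | zero => ext i j; simp
  | add x y hx hy => rw [map_add, map_add, map_add, ← hx, ← hy]; ext i j; simp
  | tmul a e =>
    ext i j
    simp [Algebra.leftMulMatrix_eq_repr_mul, Algebra.TensorProduct.basis_apply]

theorem map_mem_torusPoints {A B : Type*} [CommRing A] [Algebra K A] [CommRing B]
    [Algebra K B] (f : A →ₐ[K] B) {X : GL (Fin n) A} (hX : X ∈ torusPoints b A) :
    Matrix.GeneralLinearGroup.map f.toRingHom X ∈ torusPoints b B := by
  obtain ⟨z, rfl⟩ := hX
  refine ⟨Units.map (Algebra.TensorProduct.map f (AlgHom.id K E)).toMonoidHom z, ?_⟩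
  apply Units.ext
  exact (leftMulMatrix_baseChange_map b f z).symm

/-- `T(A) → T(B)`, applying a homomorphism `A → B` of `K`-algebras to the entries. -/
def torusPointsMap {A B : Type*} [CommRing A] [Algebra K A] [CommRing B] [Algebra K B]
    (f : A →ₐ[K] B) : torusPoints b A →* torusPoints b B :=
  ((Matrix.GeneralLinearGroup.map f.toRingHom).comp (torusPoints b A).subtype).codRestrict
    (torusPoints b B) fun X => map_mem_torusPoints b f X.2

/-- The points of the torus over the algebraic closure of `K`. -/
abbrev GeomPoints := torusPoints b (AlgebraicClosure K)

/-- The coordinate function `X ↦ X_ij` on the torus. -/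
def coordFun (i j : Fin n) : GeomPoints b → AlgebraicClosure K := fun X => X.1 i j

/-- The function `X ↦ (det X)⁻¹` on the torus. -/
def detInvFun : GeomPoints b → AlgebraicClosure K := fun X => (X.1.1.det)⁻¹

/-- The coordinate ring `K[T]`: the functions on `T(K̄)` that are polynomials with coefficients in
`K` in the matrix entries and the inverse of the determinant. -/
def coordRing : Subalgebra K (GeomPoints b → AlgebraicClosure K) :=
  Algebra.adjoin K (Set.range (fun ij : Fin n × Fin n => coordFun b ij.1 ij.2) ∪ {detInvFun b})

theorem coordFun_mem (i j : Fin n) : coordFun b i j ∈ coordRing b :=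
  Algebra.subset_adjoin (Or.inl ⟨(i, j), rfl⟩)

theorem detInvFun_mem : detInvFun b ∈ coordRing b :=
  Algebra.subset_adjoin (Or.inr rfl)

/-- Composition with a self-map `h` of `T(K̄)` preserves `K[T]` as soon as it maps the coordinates
and the inverse of the determinant into `K[T]`. -/
theorem comp_mem_coordRing (h : GeomPoints b → GeomPoints b)
    (h₁ : ∀ i j, coordFun b i j ∘ h ∈ coordRing b) (h₂ : detInvFun b ∘ h ∈ coordRing b)
    {f : GeomPoints b → AlgebraicClosure K} (hf : f ∈ coordRing b) : f ∘ h ∈ coordRing b := by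
  induction hf using Algebra.adjoin_induction with
  | mem x hx =>
    rcases hx with ⟨ij, rfl⟩ | hx
    · exact h₁ _ _
    · rw [Set.mem_singleton_iff] at hx
      rw [hx]
      exact h₂
  | algebraMap r => exact (coordRing b).algebraMap_mem r
  | add x y _ _ hx hy => exact (coordRing b).add_mem hx hy
  | mul x y _ _ hx hy => exact (coordRing b).mul_mem hx hy

/-- The endomorphism `f ↦ f ∘ h` of `K[T]`, for a self-map `h` of `T(K̄)` as above. -/
def comorphism (h : GeomPoints b → GeomPoints b)
    (h₁ : ∀ i j, coordFun b i j ∘ h ∈ coordRing b) (h₂ : detInvFun b ∘ h ∈ coordRing b) :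
    coordRing b →ₐ[K] coordRing b where
  toFun f := ⟨f.1 ∘ h, comp_mem_coordRing b h h₁ h₂ f.2⟩
  map_one' := rfl
  map_mul' _ _ := rfl
  map_zero' := rfl
  map_add' _ _ := rfl
  commutes' _ := rfl

/-- The inclusion `T(K) → T(K̄)`. -/
def rationalPoint : torusPoints b K →* GeomPoints b :=
  torusPointsMap b (Algebra.ofId K (AlgebraicClosure K))

theorem coordFun_comp_mul_mem (g : torusPoints b K) (i j : Fin n) :
    coordFun b i j ∘ (· * rationalPoint b g) ∈ coordRing b := by
  have : coordFun b i j ∘ (· * rationalPoint b g) =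
      ∑ k, (g.1 k j) • coordFun b i k := by
    funext X
    simp only [Function.comp_apply, Finset.sum_apply, Pi.smul_apply]
    simp only [coordFun, Algebra.smul_def]
    refine (Matrix.mul_apply).trans (Finset.sum_congr rfl fun k _ => mul_comm _ _)
  rw [this]
  exact (coordRing b).sum_mem fun k _ => (coordRing b).smul_mem (coordFun_mem b i k) _

theorem detInvFun_comp_mul_mem (g : torusPoints b K) :
    detInvFun b ∘ (· * rationalPoint b g) ∈ coordRing b := by
  have : detInvFun b ∘ (· * rationalPoint b g) = (g.1.1.det)⁻¹ • detInvFun b := by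
    funext X
    have hd : ((rationalPoint b g).1.1).det = algebraMap K (AlgebraicClosure K) g.1.1.det :=
      (RingHom.map_det (algebraMap K (AlgebraicClosure K)) g.1.1).symm
    have hm : ((X * rationalPoint b g).1.1).det = X.1.1.det * ((rationalPoint b g).1.1).det :=
      Matrix.det_mul _ _
    simp only [Function.comp_apply, Pi.smul_apply]
    simp only [detInvFun, Algebra.smul_def, hm, hd, map_inv₀, mul_inv]
    exact mul_comm _ _
  rw [this]
  exact (coordRing b).smul_mem (detInvFun_mem b) _

/-- The action of `T(K)` on `K[T]` by `(g • f)(X) = f(X g)`. -/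
instance torusAction : MulSemiringAction (torusPoints b K) (coordRing b) where
  smul g f := comorphism b (· * rationalPoint b g) (coordFun_comp_mul_mem b g)
    (detInvFun_comp_mul_mem b g) f
  one_smul f := by
    apply Subtype.ext
    funext X
    change f.1 (X * rationalPoint b 1) = f.1 X
    rw [map_one, mul_one]
  mul_smul g h f := by
    apply Subtype.ext
    funext X
    change f.1 (X * rationalPoint b (g * h)) = f.1 (X * rationalPoint b g * rationalPoint b h)
    rw [map_mul, mul_assoc]
  smul_zero _ := rfl
  smul_add _ _ _ := rfl
  smul_one _ := rfl
  smul_mul _ _ _ := rfl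

section Lang

variable [Fintype K]

/-- The map `X ↦ X^(q)` raising all matrix entries to the power `q = |K|`, on `T(K̄)`. -/
def torusFrobenius : GeomPoints b →* GeomPoints b :=
  torusPointsMap b (FiniteField.frobeniusAlgHom K (AlgebraicClosure K))

/-- The Lang map `X ↦ X (X^(q))⁻¹` on `T(K̄)`. -/
def langMap (X : GeomPoints b) : GeomPoints b := X * (torusFrobenius b X)⁻¹

theorem coordFun_comp_langMap_mem (i j : Fin n) : coordFun b i j ∘ langMap b ∈ coordRing b := by
  let U : Matrix (Fin n) (Fin n) (coordRing b) := fun i j => ⟨coordFun b i j, coordFun_mem b i j⟩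
  let V : Matrix (Fin n) (Fin n) (coordRing b) := U.map (· ^ Fintype.card K)
  let d : coordRing b := ⟨detInvFun b, detInvFun_mem b⟩
  have key : coordFun b i j ∘ langMap b =
      ((U * (d ^ Fintype.card K • V.adjugate)) i j : coordRing b).1 := by
    funext X
    let ev : coordRing b →+* AlgebraicClosure K :=
      (Pi.evalRingHom (fun _ : GeomPoints b => AlgebraicClosure K) X).comp
        (coordRing b).val.toRingHom
    have hV : ev.mapMatrix V = (torusFrobenius b X).1.1 := by
      ext k l
      exact map_pow ev (U k l) _
    have hU : ev.mapMatrix U = X.1.1 := rfl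
    have hdet : (torusFrobenius b X).1.1.det = X.1.1.det ^ Fintype.card K :=
      (RingHom.map_det
        (FiniteField.frobeniusAlgHom K (AlgebraicClosure K)).toRingHom X.1.1).symm
    have hd : ev (d ^ Fintype.card K) = ((torusFrobenius b X).1.1.det)⁻¹ := by
      rw [map_pow, hdet, ← inv_pow]; rfl
    have hinv : (((torusFrobenius b X)⁻¹).1.1) = ((torusFrobenius b X).1.1)⁻¹ :=
      Matrix.coe_units_inv (torusFrobenius b X).1
    change (X.1.1 * ((torusFrobenius b X)⁻¹).1.1) i j = ev ((U * (d ^ Fintype.card K • V.adjugate)) i j)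
    have : ev ((U * (d ^ Fintype.card K • V.adjugate)) i j) =
        (ev.mapMatrix (U * (d ^ Fintype.card K • V.adjugate))) i j := rfl
    rw [this, map_mul, hU, hinv, Matrix.inv_def, Ring.inverse_eq_inv', ← hd, ← hV,
      ← RingHom.map_adjugate]
    congr 2
  rw [key]
  exact Subtype.property _

theorem detInvFun_comp_langMap_mem : detInvFun b ∘ langMap b ∈ coordRing b := by
  let U : Matrix (Fin n) (Fin n) (coordRing b) := fun i j => ⟨coordFun b i j, coordFun_mem b i j⟩
  let d : coordRing b := ⟨detInvFun b, detInvFun_mem b⟩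
  have key : detInvFun b ∘ langMap b = (d * U.det ^ Fintype.card K : coordRing b).1 := by
    funext X
    let ev : coordRing b →+* AlgebraicClosure K :=
      (Pi.evalRingHom (fun _ : GeomPoints b => AlgebraicClosure K) X).comp
        (coordRing b).val.toRingHom
    have hU : ev U.det = X.1.1.det := RingHom.map_det ev U
    have hdet : (torusFrobenius b X).1.1.det = X.1.1.det ^ Fintype.card K :=
      (RingHom.map_det
        (FiniteField.frobeniusAlgHom K (AlgebraicClosure K)).toRingHom X.1.1).symm
    have hinv : (((torusFrobenius b X)⁻¹).1.1) = ((torusFrobenius b X).1.1)⁻¹ :=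
      Matrix.coe_units_inv (torusFrobenius b X).1
    change ((X.1.1 * ((torusFrobenius b X)⁻¹).1.1).det)⁻¹ = ev (d * U.det ^ Fintype.card K)
    rw [map_mul, map_pow, hU, Matrix.det_mul, hinv, Matrix.det_nonsing_inv, Ring.inverse_eq_inv',
      mul_inv, inv_inv, hdet]
    rfl
  rw [key]
  exact Subtype.property _

/-- The comorphism `λ* : K[T] → K[T]`, `f ↦ f ∘ λ`, of the Lang map `λ`. -/
def langComorphism : coordRing b →ₐ[K] coordRing b :=
  comorphism b (langMap b) (coordFun_comp_langMap_mem b) (detInvFun_comp_langMap_mem b)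

end Lang

end Torus

end

/-!
The Lang map `λ : T → T` of the torus `T = Res_{E/K} G_m` over a finite field `K` with `q` elements
is a Galois covering with group `T(K) = Eˣ`. It is generic because a Galois algebra `M` over `L`
with this group is the pullback of `λ` along a point of `T` over `L`, by Hilbert's Theorem 90.

*Galois property.* Write `S = K[T]` and `R = λ* S`, let `U` be the universal point of `T` and let
`x_k` be the coordinates. Since `λ* U = U (U^(q))⁻¹`, each `x_k ^ q` is an `R`-linear combination of
the `x_l`, and `det U ^ (q - 1)` is a unit of `R`. The coefficient of `∏ x_k ^ (q - 1)` in
`det U ^ (q - 1)` is nonzero, so this monomial too reduces to lower ones, and `S` is spanned over `R`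
by the monomials of degree less than `n (q - 1)` (`span_lowMonomials`). A rational point acts on the
`x_k` by a linear substitution, so the trace of such a monomial is, up to its value at the origin,
the sum over `K ^ n` of a polynomial of degree less than `n (q - 1)`, which vanishes. Hence traces
lie in `R`. As the group has order `q ^ n - 1 = -1` in `K`, every invariant is minus its own trace,
so the invariants are exactly `R` (`isGaloisExtension_langComorphism`). The action is unramified
because `U g - U = U (g - 1)` is an invertible matrix for `g ≠ 1`.

*Localized polynomial ring.* `S` is `K[x₁, …, x_n, 1 / det]` (`coordRingEquiv`). As `S` is finite
over `R`, a count of transcendence degrees shows that `λ*` is injective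
(`langComorphism_injective`), so that `R ≅ S`.

*Genericity.* An equivariant homomorphism from a Galois extension `S / R` to a Galois algebra
`M / L` always exhibits `M` as a base change of `S`
(`IsGaloisExtension.exists_equiv_baseChange`), so only such a homomorphism `S → M` is needed
(`IsGenericExtension.of_equivariant`). It is a point `X` of `T` over `M` with `σ X = X σ`, that is, a
unit of `M ⊗ E` with a prescribed transformation law. It exists by Hilbert's Theorem 90 for
`M ⊗ E` over the Artinian ring `L ⊗ E` (`IsGaloisExtension.exists_unit_smul_eq`).

Over an arbitrary field of characteristic `p`, a generic extension is obtained by base change from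
the prime field (`IsGenericExtension.baseChange`).
-/

/-! ### Galois extensions of commutative rings -/

namespace IsGaloisExtension

section

variable {G R S : Type*} [Group G] [CommRing R] [CommRing S] [Algebra R S]
  [MulSemiringAction G S]

theorem smul_algebraMap (h : IsGaloisExtension G R S) (σ : G) (r : R) :
    σ • algebraMap R S r = algebraMap R S r :=
  (h.invariant _).2 ⟨r, rfl⟩ σ

/-- A Galois extension has dual families `x`, `y` with `∑ i, x i * σ (y i) = δ_{σ, 1}`. For a single
`σ ≠ 1` the nonramification provides a combination that is `1` at the identity and `0` at `σ`;
the product of these over all `σ ≠ 1` is again such a combination. -/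
theorem exists_dual_families [Finite G] (h : IsGaloisExtension G R S) :
    ∃ (m : ℕ) (x y : Fin m → S), (∑ i, x i * y i = 1) ∧
      ∀ σ : G, σ ≠ 1 → ∑ i, x i * σ • y i = 0 := by
  classical
  cases nonempty_fintype G
  let orb : S →* (G → S) :=
    { toFun := fun y τ => τ • y
      map_one' := by ext; simp
      map_mul' := fun a b => by ext; simp }
  let B : Subalgebra S (G → S) := Algebra.adjoin S (MonoidHom.mrange orb : Set (G → S))
  have horb : ∀ y, orb y ∈ B := fun y => Algebra.subset_adjoin ⟨y, rfl⟩
  have hsep : ∀ σ : G, σ ≠ 1 → ∃ f ∈ B, f 1 = 1 ∧ f σ = 0 := by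
    intro σ hσ
    let J : Ideal S :=
      { carrier := {s | ∃ f ∈ B, f 1 = s ∧ f σ = 0}
        zero_mem' := ⟨0, B.zero_mem, rfl, rfl⟩
        add_mem' := by
          rintro _ _ ⟨f, hf, rfl, hf'⟩ ⟨g, hg, rfl, hg'⟩
          exact ⟨f + g, B.add_mem hf hg, rfl, by simp [hf', hg']⟩
        smul_mem' := by
          rintro c _ ⟨f, hf, rfl, hf'⟩
          exact ⟨c • f, B.smul_mem hf c, rfl, by simp [hf']⟩ }
    have hJ : J = ⊤ := by
      by_contra hne
      obtain ⟨m, hm, hJm⟩ := Ideal.exists_le_maximal J hne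
      obtain ⟨s, hs⟩ := h.unramified m hm σ hσ
      refine hs (hJm ⟨algebraMap S (G → S) (σ • s) - orb s,
        B.sub_mem (B.algebraMap_mem _) (horb s), ?_, ?_⟩)
      · simp [orb]
      · simp [orb]
    exact (Ideal.eq_top_iff_one J).1 hJ
  choose! f hfB hf1 hfσ using hsep
  have hprod : ∏ σ ∈ Finset.univ.erase (1 : G), f σ ∈ B :=
    B.prod_mem fun σ hσ => hfB σ (Finset.ne_of_mem_erase hσ)
  rw [← Subalgebra.mem_toSubmodule, Algebra.adjoin_eq_span, Submonoid.closure_eq,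
    Submodule.mem_span_set'] at hprod
  obtain ⟨m, x, g, hg⟩ := hprod
  choose y hy using fun i => (g i).2
  have hval : ∀ σ, ∑ i, x i * σ • y i = ∏ τ ∈ Finset.univ.erase (1 : G), f τ σ := by
    intro σ
    rw [← Finset.prod_apply, ← hg, Finset.sum_apply]
    refine Finset.sum_congr rfl fun i _ => ?_
    rw [Pi.smul_apply, ← hy i]
    rfl
  refine ⟨m, x, y, ?_, fun σ hσ => ?_⟩
  · simpa using (hval 1).trans
      (Finset.prod_eq_one fun τ hτ => hf1 τ (Finset.ne_of_mem_erase hτ))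
  · rw [hval]
    exact Finset.prod_eq_zero (Finset.mem_erase.2 ⟨hσ, Finset.mem_univ _⟩) (hfσ σ hσ)

theorem sum_smul_mem_range [Fintype G] (h : IsGaloisExtension G R S) (s : S) :
    ∃ r : R, algebraMap R S r = ∑ σ : G, σ • s := by
  refine (h.invariant _).1 fun τ => ?_
  rw [Finset.smul_sum]
  exact Fintype.sum_equiv (Equiv.mulLeft τ) _ _ fun σ => by simp [mul_smul]

end

/-- An equivariant homomorphism `ψ : S → M` from a Galois extension `S / R` to a Galois extension
`M / L` that is compatible with `R → L` exhibits `M` as the base change of `S`: the inverse of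
`L ⊗ S → M` is `m ↦ ∑ i, Tr (m ψ(y i)) ⊗ x i` for dual families `x`, `y` of `S / R`. -/
theorem exists_equiv_baseChange {G R S L M : Type*} [Group G] [Finite G]
    [CommRing R] [CommRing S] [Algebra R S] [MulSemiringAction G S]
    [CommRing L] [CommRing M] [Algebra L M] [MulSemiringAction G M] [Algebra R L]
    (hS : IsGaloisExtension G R S) (hM : IsGaloisExtension G L M) (ψ : S →+* M)
    (hψ : ∀ r, ψ (algebraMap R S r) = algebraMap L M (algebraMap R L r))
    (hequi : ∀ (σ : G) s, ψ (σ • s) = σ • ψ s) :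
    ∃ e : (L ⊗[R] S) ≃ₐ[L] M, ∀ (σ : G) (a : L) (s : S), e (a ⊗ₜ (σ • s)) = σ • e (a ⊗ₜ s) := by
  classical
  cases nonempty_fintype G
  obtain ⟨m, x, y, hxy, hxy'⟩ := hS.exists_dual_families
  choose tS htS using hS.sum_smul_mem_range
  choose tM htM using hM.sum_smul_mem_range
  let _ : Algebra R M := ((algebraMap L M).comp (algebraMap R L)).toAlgebra
  have : IsScalarTower R L M := IsScalarTower.of_algebraMap_eq fun _ => rfl
  let ψ' : S →ₐ[R] M := { ψ with commutes' := hψ }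
  let f : (L ⊗[R] S) →ₐ[L] M :=
    Algebra.TensorProduct.lift (Algebra.ofId L M) ψ' fun _ _ => Commute.all _ _
  have hf : ∀ a s, f (a ⊗ₜ s) = algebraMap L M a * ψ s := fun a s =>
    Algebra.TensorProduct.lift_tmul _ _ _ _ _
  have htM_add : ∀ a b, tM (a + b) = tM a + tM b := fun a b => hM.injective <| by
    simp [htM, Finset.sum_add_distrib]
  have htM_mul : ∀ a s, tM (algebraMap L M a * ψ s) = a * algebraMap R L (tS s) := fun a s =>
    hM.injective <| by
      rw [htM, map_mul, ← hψ, htS, map_sum, Finset.mul_sum]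
      refine Finset.sum_congr rfl fun σ _ => ?_
      rw [smul_mul', hM.smul_algebraMap, hequi]
  have hexp : ∀ s, ∑ i, tS (s * y i) • x i = s := by
    intro s
    have : ∀ i, tS (s * y i) • x i = ∑ σ : G, σ • s * (x i * σ • y i) := by
      intro i
      rw [Algebra.smul_def, htS, Finset.sum_mul]
      exact Finset.sum_congr rfl fun σ _ => by rw [smul_mul']; ring
    rw [Finset.sum_congr rfl fun i _ => this i, Finset.sum_comm]
    simp only [← Finset.mul_sum]
    rw [Finset.sum_eq_single 1 (fun σ _ hσ => by rw [hxy' σ hσ, mul_zero]) (by simp)]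
    simp [hxy]
  let g : M → L ⊗[R] S := fun m => ∑ i, tM (m * ψ (y i)) ⊗ₜ x i
  have hg_add : ∀ a b, g (a + b) = g a + g b := fun a b => by
    simp [g, add_mul, htM_add, TensorProduct.add_tmul, Finset.sum_add_distrib]
  have hg_zero : g 0 = 0 := by simpa using hg_add 0 0
  have hgf : ∀ t, g (f t) = t := by
    intro t
    induction t using TensorProduct.induction_on with
    | zero => rw [map_zero, hg_zero]
    | add a b ha hb => rw [map_add, hg_add, ha, hb]
    | tmul a s =>
      have : ∀ i, tM (f (a ⊗ₜ s) * ψ (y i)) ⊗ₜ[R] x i = a ⊗ₜ[R] (tS (s * y i) • x i) := by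
        intro i
        rw [hf, mul_assoc, ← map_mul, htM_mul, TensorProduct.tmul_smul, TensorProduct.smul_tmul',
          Algebra.smul_def, mul_comm]
      change ∑ i, _ = _
      rw [Finset.sum_congr rfl fun i _ => this i, ← TensorProduct.tmul_sum, hexp]
  have hfg : ∀ m, f (g m) = m := by
    intro m
    have : ∀ i, f (tM (m * ψ (y i)) ⊗ₜ x i) = ∑ σ : G, σ • m * ψ (x i * σ • y i) := by
      intro i
      rw [hf, htM, Finset.sum_mul]
      exact Finset.sum_congr rfl fun σ _ => by rw [smul_mul', map_mul, hequi]; ring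
    simp only [g, map_sum]
    rw [Finset.sum_congr rfl fun i _ => this i, Finset.sum_comm]
    simp only [← Finset.mul_sum, ← map_sum]
    rw [Finset.sum_eq_single 1 (fun σ _ hσ => by rw [hxy' σ hσ, map_zero, mul_zero]) (by simp)]
    simp [hxy]
  have hbij : Function.Bijective f :=
    ⟨Function.LeftInverse.injective hgf, Function.RightInverse.surjective hfg⟩
  refine ⟨AlgEquiv.ofBijective f hbij, fun σ a s => ?_⟩
  change f (a ⊗ₜ (σ • s)) = σ • f (a ⊗ₜ s)
  rw [hf, hf, smul_mul', hM.smul_algebraMap, hequi]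

/-- A `G`-ring `N` over `A` generated as an `A`-module by the image of a Galois extension `S / R`
with group `G` is Galois over `A`, provided that `|G|` is invertible in `A`: an invariant is then
`|G|⁻¹` times its own trace. -/
theorem of_span_eq_top {G R S A N : Type*} [Group G] [Fintype G]
    [CommRing R] [CommRing S] [Algebra R S] [MulSemiringAction G S]
    [CommRing A] [CommRing N] [Algebra A N] [MulSemiringAction G N]
    (hS : IsGaloisExtension G R S) (hcard : IsUnit (Fintype.card G : A))
    (hinj : Function.Injective (algebraMap A N))
    (hfix : ∀ (σ : G) (a : A), σ • algebraMap A N a = algebraMap A N a)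
    (f : S →+* N) (hf : ∀ (σ : G) s, f (σ • s) = σ • f s)
    (hR : ∀ r, f (algebraMap R S r) ∈ (algebraMap A N).range)
    (hspan : Submodule.span A (Set.range f) = ⊤) : IsGaloisExtension G A N where
  injective := hinj
  invariant z := by
    refine ⟨fun hz => ?_, fun ⟨a, ha⟩ σ => by rw [← ha, hfix]⟩
    have htr : ∀ t : N, ∑ σ : G, σ • t ∈ (algebraMap A N).range := by
      intro t
      have ht : t ∈ Submodule.span A (Set.range f) := hspan ▸ Submodule.mem_top
      induction ht using Submodule.span_induction with
      | mem t ht =>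
        obtain ⟨s, rfl⟩ := ht
        obtain ⟨r, hr⟩ := hS.sum_smul_mem_range s
        simp only [← hf, ← map_sum, ← hr]
        exact hR r
      | zero => simp
      | add t u _ _ ht hu =>
        simp only [smul_add, Finset.sum_add_distrib]
        exact add_mem ht hu
      | smul a t _ ht =>
        simp only [Algebra.smul_def, smul_mul', hfix, ← Finset.mul_sum]
        exact mul_mem ⟨a, rfl⟩ ht
    obtain ⟨a, ha⟩ := htr z
    obtain ⟨c, hc⟩ := hcard.exists_left_inv
    refine ⟨c * a, ?_⟩
    rw [map_mul, ha, Finset.sum_congr rfl fun σ _ => hz σ, Finset.sum_const, Finset.card_univ,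
      nsmul_eq_mul, ← mul_assoc, ← map_natCast (algebraMap A N), ← map_mul, hc, map_one, one_mul]
  unramified m hm σ hσ := by
    by_contra hcon
    push Not at hcon
    obtain ⟨m', hm', hle⟩ := Ideal.exists_le_maximal (m.comap f)
      (Ideal.comap_ne_top f hm.ne_top)
    obtain ⟨s, hs⟩ := hS.unramified m' hm' σ hσ
    refine hs (hle ?_)
    rw [Ideal.mem_comap, map_sub, hf]
    exact hcon (f s)

/-- A form of Hilbert's Theorem 90 over a ring with finitely many maximal ideals. With dual
families `x`, `y`, the eigenvectors `X i = ∑ σ, σ (y i) c(σ)⁻¹` and `Y i = ∑ σ, σ (x i) c(σ)` satisfy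
`∑ i, Y i * X i = |G|`, so that at each maximal ideal of `A` some `Y i * X i ∈ A` does not vanish;
the Chinese remainder theorem combines the corresponding `X i` into one unit. -/
theorem exists_unit_smul_eq {G A N : Type*} [Group G] [Fintype G] [CommRing A] [CommRing N]
    [Algebra A N] [MulSemiringAction G N] [Finite (MaximalSpectrum A)]
    (h : IsGaloisExtension G A N) (hcard : IsUnit (Fintype.card G : A)) (c : G →* Aˣ) :
    ∃ X : Nˣ, ∀ σ, σ • (X : N) = X * algebraMap A N (c σ) := by
  classical
  cases nonempty_fintype (MaximalSpectrum A)
  obtain ⟨k, x, y, hxy, hxy'⟩ := h.exists_dual_families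
  let ev : (G →* Aˣ) → N → N := fun d t => ∑ σ : G, σ • t * algebraMap A N ((d σ)⁻¹ : Aˣ)
  have hev : ∀ d t τ, τ • ev d t = ev d t * algebraMap A N (d τ) := by
    intro d t τ
    simp only [ev, Finset.smul_sum, Finset.sum_mul]
    refine Fintype.sum_equiv (Equiv.mulLeft τ) _ _ fun σ => ?_
    rw [smul_mul', h.smul_algebraMap, Equiv.coe_mulLeft, mul_smul, mul_assoc, ← map_mul,
      ← Units.val_mul]
    simp
  -- `W d` is the eigenspace of the character `d`
  let W : (G →* Aˣ) → Submodule A N := fun d =>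
    { carrier := {t | ∀ τ : G, τ • t = t * algebraMap A N (d τ)}
      zero_mem' := fun τ => by simp
      add_mem' := fun {s t} hs ht τ => by rw [smul_add, hs τ, ht τ, add_mul]
      smul_mem' := fun a t ht τ => by
        rw [Algebra.smul_def, smul_mul', h.smul_algebraMap, ht τ, mul_assoc] }
  have hW : ∀ X ∈ W c, ∀ Y ∈ W c⁻¹, ∃ a, algebraMap A N a = Y * X := by
    intro X hX Y hY
    refine (h.invariant _).1 fun σ => ?_
    rw [smul_mul', hX σ, hY σ, mul_mul_mul_comm, ← map_mul, ← Units.val_mul]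
    simp
  have hmem : ∀ d t, ev d t ∈ W d := fun d t τ => hev d t τ
  have hsum : ∑ i, ev c⁻¹ (x i) * ev c (y i) = algebraMap A N (Fintype.card G : A) := by
    have h1 : ∀ i, ev c⁻¹ (x i) * ev c (y i) = ∑ σ : G, ∑ τ : G,
        algebraMap A N (c σ) * algebraMap A N ((c τ)⁻¹ : Aˣ) * σ • (x i * (σ⁻¹ * τ) • y i) := by
      intro i
      simp only [ev, Finset.sum_mul_sum]
      refine Finset.sum_congr rfl fun σ _ => Finset.sum_congr rfl fun τ _ => ?_
      rw [smul_mul', ← mul_smul σ, mul_inv_cancel_left, MonoidHom.inv_apply, inv_inv]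
      ring
    rw [Finset.sum_congr rfl fun i _ => h1 i, Finset.sum_comm]
    have h2 : ∀ σ : G, ∑ i, ∑ τ : G, algebraMap A N (c σ) * algebraMap A N ((c τ)⁻¹ : Aˣ) *
        σ • (x i * (σ⁻¹ * τ) • y i) = 1 := by
      intro σ
      rw [Finset.sum_comm]
      simp only [← Finset.mul_sum, ← Finset.smul_sum]
      rw [Finset.sum_eq_single σ]
      · simp [hxy, ← map_mul]
      · intro τ _ hτ
        rw [hxy' _ (by rwa [ne_eq, inv_mul_eq_one, eq_comm]), smul_zero, mul_zero]
      · simp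
    rw [Finset.sum_congr rfl fun σ _ => h2 σ]
    simp
  choose a ha using fun i => hW _ (hmem c (y i)) _ (hmem c⁻¹ (x i))
  have hasum : ∑ i, a i = (Fintype.card G : A) := h.injective <| by
    rw [map_sum, ← hsum]
    exact Finset.sum_congr rfl fun i _ => ha i
  have hloc : ∀ m : MaximalSpectrum A, ∃ i, a i ∉ m.asIdeal := by
    intro m
    by_contra hcon
    push Not at hcon
    refine m.isMaximal.ne_top (Ideal.eq_top_of_isUnit_mem _ ?_ hcard)
    rw [← hasum]
    exact sum_mem fun i _ => hcon i
  choose i hi using hloc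
  have hcop : Pairwise (Function.onFun IsCoprime fun m : MaximalSpectrum A => m.asIdeal) :=
    fun m m' hne => Ideal.isCoprime_iff_sup_eq.2 <|
      m.isMaximal.coprime_of_ne m'.isMaximal fun heq => hne (MaximalSpectrum.ext heq)
  choose r hr using fun m : MaximalSpectrum A =>
    Ideal.pi_quotient_surjective hcop (Pi.single m (1 : A ⧸ m.asIdeal))
  let X : N := ∑ m, r m • ev c (y (i m))
  let Y : N := ∑ m, r m • ev c⁻¹ (x (i m))
  have hX : X ∈ W c := sum_mem fun m _ => (W c).smul_mem _ (hmem _ _)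
  have hY : Y ∈ W c⁻¹ := sum_mem fun m _ => (W c⁻¹).smul_mem _ (hmem _ _)
  choose a' ha' using fun m m' => hW _ (hmem c (y (i m'))) _ (hmem c⁻¹ (x (i m)))
  have hYX : Y * X = algebraMap A N (∑ m, ∑ m', r m * r m' * a' m m') := by
    simp only [X, Y, Finset.sum_mul_sum, map_sum, map_mul, ha', Algebra.smul_def]
    exact Finset.sum_congr rfl fun m _ => Finset.sum_congr rfl fun m' _ => by ring
  have hunit : IsUnit (∑ m, ∑ m', r m * r m' * a' m m') := by
    by_contra hnu
    obtain ⟨I, hI, hmemI⟩ := exists_max_ideal_of_mem_nonunits hnu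
    let m₀ : MaximalSpectrum A := ⟨I, hI⟩
    have hmod : Ideal.Quotient.mk m₀.asIdeal (∑ m, ∑ m', r m * r m' * a' m m') =
        Ideal.Quotient.mk m₀.asIdeal (a' m₀ m₀) := by
      simp only [map_sum, map_mul, hr]
      rw [Finset.sum_eq_single m₀, Finset.sum_eq_single m₀]
      · simp
      · intro m _ hm
        rw [Pi.single_eq_of_ne hm.symm]; simp
      · simp
      · intro m _ hm
        rw [Pi.single_eq_of_ne hm.symm]; simp
      · simp
    have haa : a' m₀ m₀ = a (i m₀) := h.injective <| by rw [ha', ha]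
    refine hi m₀ ?_
    rw [← haa, ← Ideal.Quotient.eq_zero_iff_mem, ← hmod, Ideal.Quotient.eq_zero_iff_mem]
    exact hmemI
  have hXu : IsUnit X := isUnit_of_mul_isUnit_right (hYX ▸ hunit.map (algebraMap A N))
  exact ⟨hXu.unit, fun σ => hX σ⟩

/-- A Galois extension stays Galois when the group acts through an isomorphism. -/
theorem of_mulEquiv {G H R S : Type*} [Group G] [Group H] [CommRing R] [CommRing S] [Algebra R S]
    [MulSemiringAction G S] [MulSemiringAction H S] (h : IsGaloisExtension G R S) (e : H ≃* G)
    (he : ∀ (τ : H) (s : S), τ • s = e τ • s) : IsGaloisExtension H R S where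
  injective := h.injective
  invariant s := by
    rw [← h.invariant s]
    exact ⟨fun hs σ => by simpa [he] using hs (e.symm σ), fun hs τ => by rw [he, hs]⟩
  unramified m hm τ hτ := by
    simp only [he]
    exact h.unramified m hm (e τ) (by simpa using hτ)

end IsGaloisExtension

/-- For a Galois extension `S / R` with `R` a localized polynomial ring to be generic, it is enough
that every Galois algebra receives an equivariant homomorphism from `S`: it takes the invariants
`R` to the invariants `L`, and induces the isomorphism from the base change. -/
theorem IsGenericExtension.of_equivariant {K : Type*} [Field K] {G : Type*} [Group G] [Finite G]
    {R S : Type*} [CommRing R] [CommRing S] [Algebra K R] [Algebra R S] [MulSemiringAction G S]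
    (hS : IsGaloisExtension G R S) (hR : IsLocalizedPolynomialRing K R)
    (H : ∀ (L : Type u) [Field L] [Algebra K L] (M : Type v) [CommRing M] [Algebra L M]
      [MulSemiringAction G M], IsGaloisExtension G L M →
      ∃ ψ : S →+* M, (∀ k : K, ψ (algebraMap R S (algebraMap K R k)) =
        algebraMap L M (algebraMap K L k)) ∧ ∀ (σ : G) s, ψ (σ • s) = σ • ψ s) :
    IsGenericExtension.{u, v} K G R S where
  isGalois := hS
  isLocalized := hR
  generic L _ _ M _ _ _ hM := by
    obtain ⟨ψ, hψ, hequi⟩ := H L M hM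
    have hex : ∀ r : R, ∃ a : L, algebraMap L M a = ψ (algebraMap R S r) := fun r =>
      (hM.invariant _).1 fun σ => by rw [← hequi, hS.smul_algebraMap]
    choose φ hφ using hex
    let φ' : R →ₐ[K] L :=
      { toFun := φ
        map_one' := hM.injective <| by simp [hφ]
        map_mul' := fun a b => hM.injective <| by simp [hφ]
        map_zero' := hM.injective <| by simp [hφ]
        map_add' := fun a b => hM.injective <| by simp [hφ]
        commutes' := fun k => hM.injective <| by rw [hφ, hψ] }
    refine ⟨φ', ?_⟩
    let _ : Algebra R L := φ'.toRingHom.toAlgebra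
    exact hS.exists_equiv_baseChange hM ψ (fun r => (hφ r).symm) hequi

noncomputable section

/-! ### Power sums over the points of affine space -/

section PowerSums

variable {K : Type*} [Field K] [Fintype K] {ι : Type*} [Fintype ι] [DecidableEq ι]

theorem sum_prod_pow_eq_zero {m : ι → ℕ} (hm : ∃ k, m k < Fintype.card K - 1) :
    ∑ v : ι → K, ∏ k, v k ^ m k = 0 := by
  obtain ⟨k, hk⟩ := hm
  have h := Finset.prod_univ_sum (fun _ : ι => (Finset.univ : Finset K)) fun i t => t ^ m i
  rw [Fintype.piFinset_univ] at h
  rw [← h]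
  exact Finset.prod_eq_zero (Finset.mem_univ k) (FiniteField.sum_pow_lt_card_sub_one K _ hk)

/-- A polynomial over a `K`-algebra of degree less than `n (q - 1)` sums to zero over `K ^ n`. -/
theorem MvPolynomial.sum_eval_algebraMap_eq_zero {A : Type*} [CommRing A] [Algebra K A]
    (f : MvPolynomial ι A) (hf : f.totalDegree < (Fintype.card K - 1) * Fintype.card ι) :
    ∑ v : ι → K, MvPolynomial.eval (fun k => algebraMap K A (v k)) f = 0 := by
  simp only [MvPolynomial.eval_eq']
  rw [Finset.sum_comm]
  refine Finset.sum_eq_zero fun m hm => ?_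
  rw [← Finset.mul_sum]
  have : ∑ v : ι → K, ∏ k, algebraMap K A (v k) ^ m k =
      algebraMap K A (∑ v : ι → K, ∏ k, v k ^ m k) := by
    simp only [map_sum, map_prod, map_pow]
  rw [this, sum_prod_pow_eq_zero (f.exists_degree_lt _ hf hm), map_zero, mul_zero]

end PowerSums

/-! ### Coordinates on the torus -/

section Torus

variable {K E : Type*} [Field K] [Field E] [Algebra K E] {n : ℕ} (b : Module.Basis (Fin n) K E)

section Points

variable {A : Type*} [CommRing A] [Algebra K A]

/-- The matrix over `A` of multiplication by `∑ v_k b_k`. -/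
def mulMatrix (v : Fin n → A) : Matrix (Fin n) (Fin n) A :=
  (genericMatrix b).map (MvPolynomial.aeval v)

theorem mulMatrix_apply (v : Fin n → A) (i j : Fin n) :
    mulMatrix b v i j = ∑ k, algebraMap K A (Algebra.leftMulMatrix b (b k) i j) * v k := by
  simp [mulMatrix, genericMatrix]

theorem det_mulMatrix (v : Fin n → A) :
    (mulMatrix b v).det = MvPolynomial.aeval v (genericMatrix b).det :=
  (AlgHom.map_det (MvPolynomial.aeval v) (genericMatrix b)).symm

theorem map_mulMatrix {B : Type*} [CommRing B] [Algebra K B] (f : A →ₐ[K] B) (v : Fin n → A) :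
    (mulMatrix b v).map f = mulMatrix b fun k => f (v k) := by
  ext i j
  simp [mulMatrix_apply]

theorem leftMulMatrix_baseChange (z : A ⊗[K] E) :
    Algebra.leftMulMatrix (Algebra.TensorProduct.basis A b) z =
      mulMatrix b ((Algebra.TensorProduct.basis A b).repr z) := by
  induction z using TensorProduct.induction_on with
  | zero => ext i j; simp [mulMatrix_apply]
  | add x y hx hy =>
    rw [map_add, hx, hy]
    ext i j
    simp [mulMatrix_apply, mul_add, Finset.sum_add_distrib]
  | tmul a e =>
    ext i j
    rw [mulMatrix_apply]
    have : ∑ k, b.repr e k • Algebra.leftMulMatrix b (b k) i j = Algebra.leftMulMatrix b e i j := by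
      conv_rhs => rw [← b.sum_repr e, map_sum, Matrix.sum_apply]
      simp
    simp only [Algebra.leftMulMatrix_eq_repr_mul, Algebra.TensorProduct.basis_apply,
      Algebra.TensorProduct.tmul_mul_tmul, mul_one, Algebra.TensorProduct.basis_repr_tmul] at this ⊢
    simp only [Finsupp.smul_apply, Finsupp.mapRange_apply, ← this, map_sum, smul_eq_mul, map_mul,
      Finset.mul_sum]
    exact Finset.sum_congr rfl fun k _ => by ring

/-- The coordinates, with respect to `b`, of the element whose multiplication matrix is `X`:
the product of `X` with the coordinate vector of `1`. -/
def torusCoords (X : Matrix (Fin n) (Fin n) A) (k : Fin n) : A :=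
  ∑ j, X k j * algebraMap K A (b.repr 1 j)

theorem mulMatrix_torusCoords (X : torusPoints b A) :
    mulMatrix b (torusCoords b X.1.1) = X.1.1 := by
  obtain ⟨_, z, rfl⟩ := X
  change mulMatrix b (torusCoords b (Algebra.leftMulMatrix (Algebra.TensorProduct.basis A b) z.1)) =
    Algebra.leftMulMatrix (Algebra.TensorProduct.basis A b) z.1
  conv_rhs => rw [leftMulMatrix_baseChange]
  congr 1
  conv_rhs => rw [← mul_one z.1, ← Algebra.leftMulMatrix_mulVec_repr]
  ext k
  simp [torusCoords, Matrix.mulVec, dotProduct, Algebra.TensorProduct.one_def]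

theorem torusCoords_mulMatrix (v : Fin n → A) : torusCoords b (mulMatrix b v) = v := by
  have hz : (Algebra.TensorProduct.basis A b).repr
      (∑ k, v k • Algebra.TensorProduct.basis A b k) = v := by
    ext k; simp [Finsupp.single_apply]
  conv_rhs => rw [← hz, ← mul_one (∑ k, v k • Algebra.TensorProduct.basis A b k),
    ← Algebra.leftMulMatrix_mulVec_repr, leftMulMatrix_baseChange, hz]
  ext k
  simp [torusCoords, Matrix.mulVec, dotProduct, Algebra.TensorProduct.one_def]

/-- The point of the torus with given coordinates. -/
def torusOfCoords (v : Fin n → A) (hv : IsUnit (mulMatrix b v).det) : torusPoints b A :=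
  ⟨((Matrix.isUnit_iff_isUnit_det _).2 hv).unit, by
    have hM := (Matrix.isUnit_iff_isUnit_det _).2 hv
    let B := Algebra.TensorProduct.basis A b
    let z := ∑ k, v k • B k
    have hz : B.repr z = v := by
      ext k; simp [z, Finsupp.single_apply]
    have hzM : Algebra.leftMulMatrix B z = mulMatrix b v := by
      rw [leftMulMatrix_baseChange, hz]
    -- the inverse of `z` has as coordinates the solution `w` of `M w = 1`
    let w : Fin n → A := (mulMatrix b v)⁻¹.mulVec (B.repr 1)
    have hw : B.repr (∑ k, w k • B k) = w := by
      ext k; simp [Finsupp.single_apply]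
    have hzw : z * ∑ k, w k • B k = 1 := by
      apply B.repr.injective
      ext1 i
      rw [← Algebra.leftMulMatrix_mulVec_repr, hzM, hw, Matrix.mulVec_mulVec,
        Matrix.mul_nonsing_inv _ hv, Matrix.one_mulVec]
    exact ⟨Units.mkOfMulEqOne _ _ hzw, Units.ext hzM⟩⟩

theorem torusPoints_ext {X Y : torusPoints b A} (h : X.1.1 = Y.1.1) : X = Y :=
  Subtype.ext (Units.ext h)

theorem torusPointsMap_coe {B : Type*} [CommRing B] [Algebra K B] (f : A →ₐ[K] B)
    (X : torusPoints b A) : (torusPointsMap b f X).1.1 = X.1.1.map f := rfl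

theorem isUnit_det_torusPoints (X : torusPoints b A) : IsUnit X.1.1.det :=
  (Matrix.isUnit_iff_isUnit_det _).1 X.1.isUnit

end Points

theorem det_genericMatrix_ne_zero : (genericMatrix b).det ≠ 0 := by
  intro h
  have h1 : (mulMatrix b (torusCoords b (1 : torusPoints b K).1.1)).det = 0 := by
    rw [det_mulMatrix, h, map_zero]
  rw [mulMatrix_torusCoords] at h1
  exact (isUnit_det_torusPoints b (1 : torusPoints b K)).ne_zero h1

/-- The coordinate function `x_k` on the torus. -/
def torusX (k : Fin n) : coordRing b :=
  ∑ j, ⟨coordFun b k j, coordFun_mem b k j⟩ * algebraMap K _ (b.repr 1 j)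

theorem torusX_apply (k : Fin n) (X : GeomPoints b) :
    (torusX b k).1 X = torusCoords b X.1.1 k := by
  simp only [torusX, torusCoords, AddSubmonoidClass.coe_finsetSum, Finset.sum_apply]
  rfl

theorem mulMatrix_torusX_apply (i j : Fin n) :
    (mulMatrix b (torusX b) i j).1 = coordFun b i j := by
  funext X
  conv_rhs => rw [coordFun, ← mulMatrix_torusCoords b X]
  simp only [mulMatrix_apply, AddSubmonoidClass.coe_finsetSum, Finset.sum_apply, ← torusX_apply]
  rfl

theorem det_mulMatrix_torusX_mul :
    (mulMatrix b (torusX b)).det * ⟨detInvFun b, detInvFun_mem b⟩ = 1 := by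
  apply Subtype.ext
  funext X
  let ev : coordRing b →+* AlgebraicClosure K :=
    (Pi.evalRingHom (fun _ : GeomPoints b => AlgebraicClosure K) X).comp
      (coordRing b).val.toRingHom
  have hU : ev.mapMatrix (mulMatrix b (torusX b)) = X.1.1 := by
    ext i j
    exact congrFun (mulMatrix_torusX_apply b i j) X
  change ev (mulMatrix b (torusX b)).det * (X.1.1.det)⁻¹ = 1
  rw [RingHom.map_det, hU, mul_inv_cancel₀ (isUnit_det_torusPoints b X).ne_zero]

/-- The universal point of the torus, with entries in its coordinate ring. -/
def universalPoint : torusPoints b (coordRing b) :=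
  torusOfCoords b (torusX b) (IsUnit.of_mul_eq_one _ (det_mulMatrix_torusX_mul b))

theorem universalPoint_apply (i j : Fin n) :
    (universalPoint b).1.1 i j = ⟨coordFun b i j, coordFun_mem b i j⟩ :=
  Subtype.ext (mulMatrix_torusX_apply b i j)

theorem det_universalPoint :
    (universalPoint b).1.1.det = MvPolynomial.aeval (torusX b) (genericMatrix b).det :=
  det_mulMatrix b _

theorem adjoin_coordFun_eq_top :
    Algebra.adjoin K ((Subtype.val : coordRing b → _) ⁻¹'
      (Set.range (fun ij : Fin n × Fin n => coordFun b ij.1 ij.2) ∪ {detInvFun b})) = ⊤ :=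
  Algebra.adjoin_adjoin_coe_preimage

/-- Homomorphisms out of the coordinate ring are determined by the image of the universal point. -/
theorem coordRing_hom_ext {A : Type*} [CommRing A] [Algebra K A] {f g : coordRing b →ₐ[K] A}
    (h : torusPointsMap b f (universalPoint b) = torusPointsMap b g (universalPoint b)) :
    f = g := by
  have hU : ∀ i j, f ⟨coordFun b i j, coordFun_mem b i j⟩ =
      g ⟨coordFun b i j, coordFun_mem b i j⟩ := by
    intro i j
    rw [← universalPoint_apply]
    exact congrFun (congrFun (congrArg (fun X : torusPoints b A => X.1.1) h) i) j
  refine AlgHom.ext_of_adjoin_eq_top (s := (Subtype.val : coordRing b → _) ⁻¹'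
    (Set.range (fun ij : Fin n × Fin n => coordFun b ij.1 ij.2) ∪ {detInvFun b})) ?_ ?_
  · exact adjoin_coordFun_eq_top b
  · rintro ⟨x, hx⟩ (⟨ij, rfl⟩ | hx')
    · exact hU _ _
    · obtain rfl : x = detInvFun b := hx'
      have hdet : f (mulMatrix b (torusX b)).det = g (mulMatrix b (torusX b)).det := by
        rw [AlgHom.map_det, AlgHom.map_det]
        congr 1
        ext i j
        have := hU i j
        rw [← universalPoint_apply] at this
        exact this
      have h1 := congrArg f (det_mulMatrix_torusX_mul b)
      have h2 := congrArg g (det_mulMatrix_torusX_mul b)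
      rw [map_mul, map_one] at h1 h2
      rw [← hdet] at h2
      exact left_inv_eq_right_inv ((mul_comm _ _).trans h1) h2

/-- A polynomial that vanishes on the torus vanishes, after multiplication by `det`, at all points
of affine space over the infinite field `K̄`, and is hence zero. -/
theorem aeval_torusX_injective :
    Function.Injective (MvPolynomial.aeval (R := K) (torusX b)) := by
  rw [injective_iff_map_eq_zero]
  intro f hf
  have hzero : (MvPolynomial.map (algebraMap K (AlgebraicClosure K)))
      (f * (genericMatrix b).det) = 0 := by
    refine MvPolynomial.funext fun v => ?_
    rw [map_zero, MvPolynomial.eval_map, ← MvPolynomial.aeval_def, map_mul, ← det_mulMatrix]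
    by_cases hv : (mulMatrix b v).det = 0
    · rw [hv, mul_zero]
    · let X : GeomPoints b := torusOfCoords b v (isUnit_iff_ne_zero.2 hv)
      let ev : coordRing b →ₐ[K] AlgebraicClosure K :=
        (Pi.evalAlgHom K (fun _ : GeomPoints b => AlgebraicClosure K) X).comp (coordRing b).val
      have hev : ∀ k, ev (torusX b k) = v k := fun k =>
        (torusX_apply b k X).trans (congrFun (torusCoords_mulMatrix b v) k)
      have h0 := congrArg ev hf
      rw [← AlgHom.comp_apply, MvPolynomial.comp_aeval, map_zero] at h0
      rw [← funext hev, h0, zero_mul]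
  rw [map_eq_zero_iff _ (MvPolynomial.map_injective _ (algebraMap K _).injective)] at hzero
  exact (mul_eq_zero.1 hzero).resolve_right (det_genericMatrix_ne_zero b)

/-- A point `X` of the torus over `A` gives a homomorphism from the localized polynomial ring. -/
def localizationEval {A : Type*} [CommRing A] [Algebra K A] (X : torusPoints b A) :
    Localization.Away (genericMatrix b).det →ₐ[K] A :=
  IsLocalization.liftAlgHom (M := Submonoid.powers (genericMatrix b).det)
    (f := MvPolynomial.aeval (torusCoords b X.1.1)) <| by
      rintro ⟨_, m, rfl⟩
      rw [map_pow, ← det_mulMatrix, mulMatrix_torusCoords]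
      exact (isUnit_det_torusPoints b X).pow m

theorem localizationEval_algebraMap {A : Type*} [CommRing A] [Algebra K A] (X : torusPoints b A)
    (f : MvPolynomial (Fin n) K) :
    localizationEval b X (algebraMap _ _ f) = MvPolynomial.aeval (torusCoords b X.1.1) f := by
  simp [localizationEval]

theorem torusCoords_universalPoint : torusCoords b (universalPoint b).1.1 = torusX b :=
  torusCoords_mulMatrix b _

theorem localizationEval_universalPoint_bijective :
    Function.Bijective (localizationEval b (universalPoint b)) := by
  constructor
  · rw [injective_iff_map_eq_zero]
    intro z hz
    obtain ⟨f, s, rfl⟩ := IsLocalization.exists_mk'_eq (Submonoid.powers (genericMatrix b).det) z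
    rw [IsLocalization.mk'_eq_zero_iff]
    have h1 : localizationEval b (universalPoint b) (algebraMap _ _ f) = 0 := by
      rw [← IsLocalization.mk'_spec' (Localization.Away (genericMatrix b).det) f s, map_mul, hz,
        mul_zero]
    rw [localizationEval_algebraMap, torusCoords_universalPoint,
      map_eq_zero_iff _ (aeval_torusX_injective b)] at h1
    exact ⟨1, by rw [h1, mul_zero]⟩
  · rw [← AlgHom.range_eq_top, ← top_le_iff, ← adjoin_coordFun_eq_top,
      Algebra.adjoin_le_iff]
    have hmat : ∀ i j, localizationEval b (universalPoint b) (algebraMap _ _ (genericMatrix b i j))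
        = ⟨coordFun b i j, coordFun_mem b i j⟩ := by
      intro i j
      rw [localizationEval_algebraMap, torusCoords_universalPoint, ← universalPoint_apply]
      rfl
    rintro ⟨x, hx⟩ (⟨ij, rfl⟩ | hx')
    · exact ⟨_, hmat _ _⟩
    · obtain rfl : x = detInvFun b := hx'
      refine ⟨IsLocalization.Away.invSelf (genericMatrix b).det, ?_⟩
      have h1 := congrArg (localizationEval b (universalPoint b))
        (IsLocalization.Away.mul_invSelf (S := Localization.Away (genericMatrix b).det)
          (genericMatrix b).det)
      rw [map_mul, map_one, localizationEval_algebraMap, torusCoords_universalPoint] at h1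
      have h2 := det_mulMatrix_torusX_mul b
      rw [det_mulMatrix] at h2
      exact left_inv_eq_right_inv ((mul_comm _ _).trans h1) h2

/-- The coordinate ring of the torus is `K[x₁, …, x_n, 1 / det]`. -/
def coordRingEquiv : Localization.Away (genericMatrix b).det ≃ₐ[K] coordRing b :=
  AlgEquiv.ofBijective (localizationEval b (universalPoint b))
    (localizationEval_universalPoint_bijective b)

theorem coordRingEquiv_algebraMap (f : MvPolynomial (Fin n) K) :
    coordRingEquiv b (algebraMap _ _ f) = MvPolynomial.aeval (torusX b) f :=
  (localizationEval_algebraMap b _ f).trans (by rw [torusCoords_universalPoint])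

theorem exists_mul_det_pow_eq_aeval (s : coordRing b) :
    ∃ (j : ℕ) (f : MvPolynomial (Fin n) K),
      s * (universalPoint b).1.1.det ^ j = MvPolynomial.aeval (torusX b) f := by
  obtain ⟨z, rfl⟩ := (coordRingEquiv b).surjective s
  obtain ⟨⟨f, ⟨_, j, rfl⟩⟩, hf⟩ :=
    IsLocalization.surj (Submonoid.powers (genericMatrix b).det) z
  refine ⟨j, f, ?_⟩
  have h := congrArg (coordRingEquiv b) hf
  rwa [map_mul, coordRingEquiv_algebraMap, coordRingEquiv_algebraMap, map_pow,
    ← det_universalPoint] at h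

/-- Evaluation of functions on the torus at a point over an arbitrary `K`-algebra `A`. -/
def coordRingEval {A : Type*} [CommRing A] [Algebra K A] (X : torusPoints b A) :
    coordRing b →ₐ[K] A :=
  (localizationEval b X).comp (coordRingEquiv b).symm.toAlgHom

theorem coordRingEval_torusX {A : Type*} [CommRing A] [Algebra K A] (X : torusPoints b A)
    (k : Fin n) : coordRingEval b X (torusX b k) = torusCoords b X.1.1 k := by
  have : (coordRingEquiv b).symm (torusX b k) =
      algebraMap (MvPolynomial (Fin n) K) _ (MvPolynomial.X k) := by
    rw [AlgEquiv.symm_apply_eq, coordRingEquiv_algebraMap, MvPolynomial.aeval_X]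
  change localizationEval b X ((coordRingEquiv b).symm (torusX b k)) = _
  rw [this, localizationEval_algebraMap, MvPolynomial.aeval_X]

theorem torusPointsMap_coordRingEval {A : Type*} [CommRing A] [Algebra K A]
    (X : torusPoints b A) : torusPointsMap b (coordRingEval b X) (universalPoint b) = X := by
  apply torusPoints_ext
  rw [torusPointsMap_coe]
  refine (map_mulMatrix b (coordRingEval b X) (torusX b)).trans ?_
  simp only [coordRingEval_torusX]
  exact mulMatrix_torusCoords b X

theorem torusPointsMap_comp {A B C : Type*} [CommRing A] [Algebra K A] [CommRing B] [Algebra K B]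
    [CommRing C] [Algebra K C] (g : B →ₐ[K] C) (f : A →ₐ[K] B) (X : torusPoints b A) :
    torusPointsMap b (g.comp f) X = torusPointsMap b g (torusPointsMap b f X) := rfl

/-! ### Rational points of the torus -/

/-- The units of `A ⊗ E` are the `A`-points of the torus. -/
def unitsEquivTorusPoints (A : Type*) [CommRing A] [Algebra K A] :
    (A ⊗[K] E)ˣ ≃* torusPoints b A :=
  MonoidHom.ofInjective (f := Units.map
    (Algebra.leftMulMatrix (Algebra.TensorProduct.basis A b)).toMonoidHom)
    (Units.map_injective (Algebra.leftMulMatrix_injective _))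

/-- The units of `E` are the `K`-points of the torus. -/
def unitsEquivRationalPoints : Eˣ ≃* torusPoints b K :=
  (Units.mapEquiv (Algebra.TensorProduct.lid K E).symm.toMulEquiv).trans
    (unitsEquivTorusPoints b K)

theorem unitsEquivRationalPoints_coe (e : Eˣ) :
    (unitsEquivRationalPoints b e).1.1 = Algebra.leftMulMatrix b (e : E) := by
  change Algebra.leftMulMatrix (Algebra.TensorProduct.basis K b) (1 ⊗ₜ (e : E)) = _
  ext i j
  simp [Algebra.leftMulMatrix_eq_repr_mul, Algebra.TensorProduct.basis_apply]

theorem torusCoords_unitsEquivRationalPoints (e : Eˣ) :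
    torusCoords b (unitsEquivRationalPoints b e).1.1 = b.repr (e : E) := by
  rw [unitsEquivRationalPoints_coe]
  ext k
  conv_rhs => rw [← mul_one (e : E), ← Algebra.leftMulMatrix_mulVec_repr]
  rfl

theorem mulMatrix_repr (e : E) : mulMatrix b (b.repr e) = Algebra.leftMulMatrix b e := by
  ext i j
  conv_rhs => rw [← b.sum_repr e, map_sum, Matrix.sum_apply]
  simp [mulMatrix_apply, mul_comm]

theorem isUnit_det_leftMulMatrix {e : E} (he : e ≠ 0) :
    IsUnit (Algebra.leftMulMatrix b e).det := by
  have := isUnit_det_torusPoints b (unitsEquivRationalPoints b (Units.mk0 e he))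
  rwa [unitsEquivRationalPoints_coe] at this

/-! ### The action of the rational points -/

/-- The value of a function on the torus at a geometric point. -/
def coordRingEvalGeom (X : GeomPoints b) : coordRing b →ₐ[K] AlgebraicClosure K :=
  (Pi.evalAlgHom K (fun _ : GeomPoints b => AlgebraicClosure K) X).comp (coordRing b).val

theorem torusPointsMap_coordRingEvalGeom (X : GeomPoints b) :
    torusPointsMap b (coordRingEvalGeom b X) (universalPoint b) = X := by
  apply torusPoints_ext
  ext i j
  exact congrFun (mulMatrix_torusX_apply b i j) X

theorem torusPoints_coordRing_ext {P Q : torusPoints b (coordRing b)}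
    (h : ∀ X : GeomPoints b, torusPointsMap b (coordRingEvalGeom b X) P =
      torusPointsMap b (coordRingEvalGeom b X) Q) : P = Q := by
  apply torusPoints_ext
  ext i j
  exact congrArg (fun Z : GeomPoints b => Z.1.1 i j) (h _)

/-- The action of a rational point on the coordinate ring, as a homomorphism of `K`-algebras. -/
def torusActionHom (g : torusPoints b K) : coordRing b →ₐ[K] coordRing b :=
  comorphism b (· * rationalPoint b g) (coordFun_comp_mul_mem b g) (detInvFun_comp_mul_mem b g)

theorem torusActionHom_apply (g : torusPoints b K) (f : coordRing b) :
    torusActionHom b g f = g • f := rfl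

theorem torusPointsMap_torusActionHom (g : torusPoints b K) :
    torusPointsMap b (torusActionHom b g) (universalPoint b) =
      universalPoint b * torusPointsMap b (Algebra.ofId K _) g := by
  refine torusPoints_coordRing_ext b fun X => ?_
  rw [map_mul, ← torusPointsMap_comp, ← torusPointsMap_comp, torusPointsMap_coordRingEvalGeom]
  have h1 : (coordRingEvalGeom b X).comp (torusActionHom b g) =
      coordRingEvalGeom b (X * rationalPoint b g) := rfl
  have h2 : (coordRingEvalGeom b X).comp (Algebra.ofId K (coordRing b)) =
      Algebra.ofId K (AlgebraicClosure K) := Subsingleton.elim _ _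
  rw [h1, h2, torusPointsMap_coordRingEvalGeom]
  rfl

theorem torusPointsMap_ofId_coe {A : Type*} [CommRing A] [Algebra K A] (g : torusPoints b K) :
    (torusPointsMap b (Algebra.ofId K A) g).1.1 = g.1.1.map (algebraMap K A) := rfl

theorem torusCoords_mul_ofId {A : Type*} [CommRing A] [Algebra K A] (X : torusPoints b A)
    (g : torusPoints b K) (k : Fin n) :
    torusCoords b (X * torusPointsMap b (Algebra.ofId K A) g).1.1 k =
      ∑ l, X.1.1 k l * algebraMap K A (torusCoords b g.1.1 l) := by
  change ∑ j, (X.1.1 * (torusPointsMap b (Algebra.ofId K A) g).1.1) k j * _ = _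
  simp only [torusPointsMap_ofId_coe, Matrix.mul_apply, Matrix.map_apply, Finset.sum_mul,
    torusCoords, map_sum, map_mul, Finset.mul_sum]
  rw [Finset.sum_comm]
  exact Finset.sum_congr rfl fun l _ => Finset.sum_congr rfl fun j _ => mul_assoc _ _ _

theorem map_torusCoords {A B : Type*} [CommRing A] [Algebra K A] [CommRing B] [Algebra K B]
    (f : A →ₐ[K] B) (X : torusPoints b A) (k : Fin n) :
    torusCoords b (torusPointsMap b f X).1.1 k = f (torusCoords b X.1.1 k) := by
  simp [torusCoords, torusPointsMap_coe]

/-- A rational point acts on the coordinates by a linear substitution. -/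
theorem smul_torusX (g : torusPoints b K) (k : Fin n) :
    g • torusX b k =
      ∑ l, (universalPoint b).1.1 k l * algebraMap K _ (torusCoords b g.1.1 l) := by
  rw [← torusActionHom_apply, ← torusCoords_universalPoint, ← map_torusCoords,
    torusPointsMap_torusActionHom, torusCoords_mul_ofId]

theorem natCast_card_eq_zero_of_algebra [Fintype E] : (Fintype.card E : K) = 0 := by
  apply (algebraMap K E).injective
  rw [map_natCast, FiniteField.cast_card_eq_zero, map_zero]

theorem isHomogeneous_det_genericMatrix : (genericMatrix b).det.IsHomogeneous n := by
  rw [Matrix.det_apply]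
  refine MvPolynomial.IsHomogeneous.sum _ _ _ fun τ _ => ?_
  have h1 : (∏ i, genericMatrix b (τ i) i).IsHomogeneous n := by
    have := MvPolynomial.IsHomogeneous.prod Finset.univ (fun i => genericMatrix b (τ i) i)
      (fun _ => 1) fun i _ => by
        rw [genericMatrix, Matrix.of_apply]
        exact MvPolynomial.IsHomogeneous.sum _ _ _ fun k _ =>
          MvPolynomial.isHomogeneous_C_mul_X _ k
    simpa using this
  rcases Int.units_eq_one_or (Equiv.Perm.sign τ) with h | h
  · simpa [h] using h1
  · simpa [h] using h1.neg

section Finite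

variable [Fintype K]

theorem comp_frobeniusAlgHom {A B : Type*} [CommRing A] [Algebra K A] [CommRing B] [Algebra K B]
    (f : A →ₐ[K] B) : f.comp (FiniteField.frobeniusAlgHom K A) =
      (FiniteField.frobeniusAlgHom K B).comp f :=
  AlgHom.ext fun x => map_pow f x _

/-! ### The Lang map -/

theorem torusPointsMap_langComorphism :
    torusPointsMap b (langComorphism b) (universalPoint b) =
      universalPoint b *
        (torusPointsMap b (FiniteField.frobeniusAlgHom K (coordRing b)) (universalPoint b))⁻¹ := by
  refine torusPoints_coordRing_ext b fun X => ?_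
  have h1 : (coordRingEvalGeom b X).comp (langComorphism b) =
      coordRingEvalGeom b (langMap b X) := AlgHom.ext fun f => rfl
  have h2 : torusPointsMap b (coordRingEvalGeom b X)
      (torusPointsMap b (langComorphism b) (universalPoint b)) = langMap b X :=
    (congrArg (fun f => torusPointsMap b f (universalPoint b)) h1).trans
      (torusPointsMap_coordRingEvalGeom b _)
  have h3 : torusPointsMap b (coordRingEvalGeom b X)
      (torusPointsMap b (FiniteField.frobeniusAlgHom K (coordRing b)) (universalPoint b)) =
      torusFrobenius b X :=
    (congrArg (fun f => torusPointsMap b f (universalPoint b))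
      (comp_frobeniusAlgHom (coordRingEvalGeom b X))).trans
      (congrArg (torusFrobenius b) (torusPointsMap_coordRingEvalGeom b X))
  refine h2.trans (Eq.symm ?_)
  rw [map_mul, map_inv]
  exact congrArg₂ (· * ·) (torusPointsMap_coordRingEvalGeom b X) (congrArg (·⁻¹) h3)

theorem smul_langComorphism (g : torusPoints b K) (f : coordRing b) :
    g • langComorphism b f = langComorphism b f := by
  apply Subtype.ext
  funext X
  change f.1 (langMap b (X * rationalPoint b g)) = f.1 (langMap b X)
  have h : torusFrobenius b (rationalPoint b g) = rationalPoint b g := by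
    have h0 : (FiniteField.frobeniusAlgHom K (AlgebraicClosure K)).comp
        (Algebra.ofId K (AlgebraicClosure K)) = Algebra.ofId K (AlgebraicClosure K) :=
      Subsingleton.elim _ _
    change torusPointsMap b _ (torusPointsMap b _ g) = torusPointsMap b _ g
    rw [← torusPointsMap_comp, h0]
  rw [langMap, map_mul, h]
  simp [langMap, mul_assoc]

/-- The `q`-th powers of the coordinates are linear combinations of the coordinates over the image
of the comorphism of the Lang map. -/
theorem torusX_pow_card (k : Fin n) :
    torusX b k ^ Fintype.card K =
      ∑ l, langComorphism b ((universalPoint b)⁻¹.1.1 k l) * torusX b l := by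
  have h : torusPointsMap b (FiniteField.frobeniusAlgHom K (coordRing b)) (universalPoint b) =
      torusPointsMap b (langComorphism b) (universalPoint b)⁻¹ * universalPoint b := by
    rw [map_inv, torusPointsMap_langComorphism]
    simp
  have hk := map_torusCoords b (FiniteField.frobeniusAlgHom K (coordRing b)) (universalPoint b) k
  rw [torusCoords_universalPoint] at hk
  refine hk.symm.trans ?_
  rw [h]
  change ∑ j, ((torusPointsMap b (langComorphism b) (universalPoint b)⁻¹).1.1 *
    (universalPoint b).1.1) k j * _ = _
  simp only [Matrix.mul_apply, ← torusCoords_universalPoint, torusCoords, Finset.sum_mul,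
    Finset.mul_sum]
  rw [Finset.sum_comm]
  exact Finset.sum_congr rfl fun l _ => Finset.sum_congr rfl fun j _ => mul_assoc _ _ _

theorem langComorphism_det_mul :
    langComorphism b (universalPoint b).1.1.det * (universalPoint b).1.1.det ^ (Fintype.card K - 1)
      = 1 := by
  have h : torusPointsMap b (langComorphism b) (universalPoint b) *
      torusPointsMap b (FiniteField.frobeniusAlgHom K (coordRing b)) (universalPoint b) =
      universalPoint b := by
    rw [torusPointsMap_langComorphism]
    simp
  have h' := congrArg (fun X : torusPoints b (coordRing b) => X.1.1.det) h
  change ((torusPointsMap b (langComorphism b) (universalPoint b)).1.1 *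
    (torusPointsMap b (FiniteField.frobeniusAlgHom K (coordRing b))
      (universalPoint b)).1.1).det = _ at h'
  have h1 := AlgHom.map_det (langComorphism b) (universalPoint b).1.1
  have h2 := AlgHom.map_det (FiniteField.frobeniusAlgHom K (coordRing b)) (universalPoint b).1.1
  have h3 : langComorphism b (universalPoint b).1.1.det * (universalPoint b).1.1.det ^ Fintype.card K
      = (universalPoint b).1.1.det := by
    refine Eq.trans ?_ h'
    rw [Matrix.det_mul]
    exact congrArg₂ (· * ·) h1 h2
  have hu := isUnit_det_torusPoints b (universalPoint b)
  refine hu.mul_right_cancel ?_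
  rw [mul_assoc, ← pow_succ, Nat.sub_add_cancel Fintype.card_pos, h3, one_mul]

/-! ### Generation over the image of the Lang comorphism by monomials of low degree -/

/-- The coefficient of `∏ x_k ^ (q - 1)` in `det ^ (q - 1)` is nonzero: all other monomials sum to
zero over `K ^ n`, while `det ^ (q - 1)` takes the value `1` at the `q ^ n - 1` nonzero points. -/
theorem coeff_det_genericMatrix_pow_ne_zero (m : Fin n →₀ ℕ) (hm : ∀ k, m k = Fintype.card K - 1) :
    ((genericMatrix b).det ^ (Fintype.card K - 1)).coeff m ≠ 0 := by
  classical
  intro hcoeff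
  set F := (genericMatrix b).det ^ (Fintype.card K - 1) with hF
  have hhom : F.IsHomogeneous (n * (Fintype.card K - 1)) :=
    (isHomogeneous_det_genericMatrix b).pow _
  have hzero : ∑ v : Fin n → K, MvPolynomial.eval v F = 0 := by
    simp only [MvPolynomial.eval_eq']
    rw [Finset.sum_comm]
    refine Finset.sum_eq_zero fun d hd => ?_
    rw [← Finset.mul_sum, sum_prod_pow_eq_zero, mul_zero]
    by_contra! hcon
    have hdeg := hhom.degree_eq_sum_deg_support hd
    have hsum : ∑ _k : Fin n, (Fintype.card K - 1) = ∑ k, d k := by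
      rw [Finset.sum_const, Finset.card_univ, Fintype.card_fin, smul_eq_mul, hdeg]
      exact Finsupp.sum_fintype d (fun _ e => e) fun _ => rfl
    have heq := (Finset.sum_eq_sum_iff_of_le fun k _ => hcon k).1 hsum
    have : d = m := Finsupp.ext fun k => by rw [hm, heq k (Finset.mem_univ k)]
    exact (MvPolynomial.mem_support_iff.1 hd) (this ▸ hcoeff)
  have : Module.Finite K E := Module.Finite.of_basis b
  have : Finite E := Module.finite_of_finite K
  cases nonempty_fintype E
  have : Nonempty (Fin n) := b.index_nonempty
  have hq : Fintype.card K - 1 ≠ 0 := Nat.sub_ne_zero_of_lt Fintype.one_lt_card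
  have hval : ∀ e : E, MvPolynomial.eval (b.equivFun e) F = if e = 0 then 0 else 1 := by
    intro e
    have h1 : MvPolynomial.eval (b.equivFun e) F =
        (Algebra.leftMulMatrix b e).det ^ (Fintype.card K - 1) := by
      rw [hF, map_pow, ← mulMatrix_repr, det_mulMatrix, MvPolynomial.aeval_eq_eval]
      rfl
    rw [h1]
    split_ifs with he
    · rw [he, map_zero, Matrix.det_zero, zero_pow hq]
    · exact FiniteField.pow_card_sub_one_eq_one _ (isUnit_det_leftMulMatrix b he).ne_zero
  rw [← b.equivFun.toEquiv.sum_comp] at hzero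
  have hcount : ∑ e : E, (if e = 0 then (0 : K) else 1) = -1 := by
    have : ∀ e : E, (if e = 0 then (0 : K) else 1) = 1 - if e = 0 then 1 else 0 := by
      intro e; split_ifs <;> simp
    simp [this, natCast_card_eq_zero_of_algebra (K := K) (E := E)]
  have : (-1 : K) = 0 := hcount ▸ (Finset.sum_congr rfl fun e _ => (hval e).symm).trans hzero
  simp at this

end Finite

theorem prod_torusX_pow_add_single (m : Fin n → ℕ) (k : Fin n) (d : ℕ) :
    ∏ i, torusX b i ^ (m + Pi.single k d : Fin n → ℕ) i = torusX b k ^ d * ∏ i, torusX b i ^ m i := by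
  have h : ∏ i, torusX b i ^ (Pi.single k d : Fin n → ℕ) i = torusX b k ^ d := by
    rw [Finset.prod_eq_single k (fun i _ hi => by simp [Pi.single_eq_of_ne hi]) (by simp)]
    simp
  simp only [Pi.add_apply, pow_add, Finset.prod_mul_distrib, h]
  exact mul_comm _ _

section Finite

variable [Fintype K]

/-- The monomials of degree less than `n (q - 1)` in the coordinates of the torus. -/
def lowMonomials : Set (coordRing b) :=
  {s | ∃ m : Fin n → ℕ, ∑ k, m k < (Fintype.card K - 1) * n ∧ s = ∏ k, torusX b k ^ m k}

/-- Every monomial in the coordinates reduces to monomials of degree less than `n (q - 1)`. A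
factor `x_k ^ q` is replaced by a linear form. The only other monomial of degree at least
`n (q - 1)` is `∏ x_k ^ (q - 1)`, which occurs in `det ^ (q - 1)`, an element of the base ring. -/
theorem prod_torusX_pow_mem_span (m : Fin n → ℕ) :
    ∏ k, torusX b k ^ m k ∈ Submodule.span (langComorphism b).range (lowMonomials b) := by
  classical
  have : Nonempty (Fin n) := b.index_nonempty
  have hq : 1 < Fintype.card K := Fintype.one_lt_card
  have hn : 0 < n := Fin.pos_iff_nonempty.2 this
  induction hd : ∑ k, m k using Nat.strong_induction_on generalizing m with
  | _ d ih =>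
    set V := Submodule.span (langComorphism b).range (lowMonomials b) with hV
    have hlin : ∀ (f s : coordRing b), s ∈ V → langComorphism b f * s ∈ V := fun f s hs =>
      V.smul_mem (⟨_, f, rfl⟩ : (langComorphism b).range) hs
    -- replacing `x_k ^ q` by a linear form lowers the degree by `q - 1`
    have hlow : ∀ m' : Fin n → ℕ, ∑ k, m' k = d → (∃ k, Fintype.card K ≤ m' k) →
        ∏ k, torusX b k ^ m' k ∈ V := by
      rintro m' hm' ⟨k, hk⟩
      let m₀ : Fin n → ℕ := Function.update m' k (m' k - Fintype.card K)
      have hm₀ : m' = m₀ + Pi.single k (Fintype.card K) := by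
        funext i
        by_cases hi : i = k
        · subst hi
          simp [m₀, Nat.sub_add_cancel hk]
        · simp [m₀, hi]
      have hdeg : ∑ i, m₀ i + Fintype.card K = d := by
        rw [← hm']
        conv_rhs => rw [hm₀]
        simp [Finset.sum_add_distrib]
      rw [hm₀, prod_torusX_pow_add_single b, torusX_pow_card, Finset.sum_mul]
      refine sum_mem fun l _ => ?_
      rw [mul_assoc]
      refine hlin _ _ ?_
      have h1 := prod_torusX_pow_add_single b m₀ l 1
      rw [pow_one] at h1
      rw [← h1]
      refine ih (∑ i, (m₀ + Pi.single l 1 : Fin n → ℕ) i) ?_ _ rfl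
      simp [Finset.sum_add_distrib]
      omega
    by_cases hsmall : d < (Fintype.card K - 1) * n
    · exact Submodule.subset_span ⟨m, hd ▸ hsmall, rfl⟩
    by_cases hbig : ∃ k, Fintype.card K ≤ m k
    · exact hlow m hd hbig
    push Not at hbig
    have hle : ∀ k ∈ Finset.univ, m k ≤ Fintype.card K - 1 := fun k _ =>
      Nat.le_sub_one_of_lt (hbig k)
    have hconst : ∑ _k : Fin n, (Fintype.card K - 1) = (Fintype.card K - 1) * n := by
      simp [mul_comm]
    have hsum : ∑ k, m k = ∑ _k : Fin n, (Fintype.card K - 1) :=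
      le_antisymm (Finset.sum_le_sum hle) (by rw [hconst, hd]; exact not_lt.1 hsmall)
    -- the remaining monomial has all exponents equal to `q - 1`
    have htop := (Finset.sum_eq_sum_iff_of_le hle).1 hsum
    let M : Fin n →₀ ℕ := Finsupp.equivFunOnFinite.symm m
    set F := (genericMatrix b).det ^ (Fintype.card K - 1) with hF
    have hhom : F.IsHomogeneous (n * (Fintype.card K - 1)) :=
      (isHomogeneous_det_genericMatrix b).pow _
    have hc : F.coeff M ≠ 0 :=
      coeff_det_genericMatrix_pow_ne_zero b M fun k => htop k (Finset.mem_univ k)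
    have hone : (1 : coordRing b) ∈ V := Submodule.subset_span
      ⟨0, by simpa using ⟨hq, hn⟩, by simp⟩
    -- `det ^ (q - 1)` is the image under `λ*` of the inverse of `det`
    have hFV : MvPolynomial.aeval (torusX b) F ∈ V := by
      have hu := isUnit_det_torusPoints b (universalPoint b)
      have h1 := langComorphism_det_mul b
      obtain ⟨f, hf⟩ := hu.exists_left_inv
      have h2 : MvPolynomial.aeval (torusX b) F = langComorphism b f := by
        rw [hF, map_pow, ← det_universalPoint]
        have h3 := congrArg (langComorphism b) hf
        rw [map_mul, map_one] at h3
        exact (left_inv_eq_right_inv h3 h1).symm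
      rw [h2, ← mul_one (langComorphism b f)]
      exact hlin _ _ hone
    have hsplit : MvPolynomial.aeval (torusX b) F =
        algebraMap K _ (F.coeff M) * ∏ k, torusX b k ^ m k +
        ∑ d ∈ F.support.erase M, algebraMap K _ (F.coeff d) * ∏ k, torusX b k ^ d k := by
      rw [MvPolynomial.aeval_def, MvPolynomial.eval₂_eq',
        ← Finset.add_sum_erase _ _ (MvPolynomial.mem_support_iff.2 hc)]
      rfl
    have hrest : ∑ d ∈ F.support.erase M, algebraMap K _ (F.coeff d) * ∏ k, torusX b k ^ d k
        ∈ V := by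
      refine sum_mem fun e he => ?_
      rw [← (langComorphism b).commutes]
      refine hlin _ _ (hlow e ?_ ?_)
      · have := hhom.degree_eq_sum_deg_support (Finset.mem_of_mem_erase he)
        rw [← hd, hsum, hconst, mul_comm, this]
        exact (Finsupp.sum_fintype e (fun _ t => t) fun _ => rfl).symm
      · by_contra! hcon
        have hle' : ∀ k ∈ Finset.univ, e k ≤ Fintype.card K - 1 := fun k _ =>
          Nat.le_sub_one_of_lt (hcon k)
        have hdeg := hhom.degree_eq_sum_deg_support (Finset.mem_of_mem_erase he)
        have hsum' : ∑ k, e k = ∑ _k : Fin n, (Fintype.card K - 1) := by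
          rw [hconst, mul_comm, hdeg]
          exact (Finsupp.sum_fintype e (fun _ t => t) fun _ => rfl).symm
        have htop' := (Finset.sum_eq_sum_iff_of_le hle').1 hsum'
        refine Finset.ne_of_mem_erase he (Finsupp.ext fun k => ?_)
        rw [htop' k (Finset.mem_univ k)]
        exact (htop k (Finset.mem_univ k)).symm
    have hmain : algebraMap K _ (F.coeff M) * ∏ k, torusX b k ^ m k ∈ V := by
      have hsub : ∀ a c s : coordRing b, s = a + c → a = s + langComorphism b (-1) * c := by
        intro a c s h
        rw [h, map_neg, map_one]
        ring
      rw [hsub _ _ _ hsplit]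
      exact V.add_mem hFV (hlin (-1) _ hrest)
    have := hlin (algebraMap K _ (F.coeff M)⁻¹) _ hmain
    rwa [AlgHom.commutes, ← mul_assoc, ← map_mul, inv_mul_cancel₀ hc, map_one, one_mul] at this

theorem span_lowMonomials :
    Submodule.span (langComorphism b).range (lowMonomials b) = ⊤ := by
  set V := Submodule.span (langComorphism b).range (lowMonomials b) with hV
  have hlin : ∀ (f s : coordRing b), s ∈ V → langComorphism b f * s ∈ V := fun f s hs =>
    V.smul_mem (⟨_, f, rfl⟩ : (langComorphism b).range) hs
  have hpoly : ∀ f : MvPolynomial (Fin n) K, MvPolynomial.aeval (torusX b) f ∈ V := by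
    intro f
    rw [MvPolynomial.aeval_def, MvPolynomial.eval₂_eq']
    refine sum_mem fun d _ => ?_
    rw [← (langComorphism b).commutes]
    exact hlin _ _ (prod_torusX_pow_mem_span b d)
  refine eq_top_iff.2 fun s _ => ?_
  obtain ⟨j, f, h1⟩ := exists_mul_det_pow_eq_aeval b s
  -- modulo the unit `det ^ (q - 1)` of the base ring, `det⁻¹` is `det ^ (q - 2)`
  have hq : Fintype.card K - 1 = 1 + (Fintype.card K - 2) := by
    have := Fintype.one_lt_card (α := K)
    omega
  have h2 := langComorphism_det_mul b
  have h3 : s = langComorphism b ((universalPoint b).1.1.det ^ j) *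
      MvPolynomial.aeval (torusX b) (f * (genericMatrix b).det ^ (j * (Fintype.card K - 2))) := by
    rw [map_mul (MvPolynomial.aeval (torusX b)), ← h1, map_pow (MvPolynomial.aeval (torusX b)),
      ← det_universalPoint, map_pow]
    generalize (universalPoint b).1.1.det = D at h2 ⊢
    generalize langComorphism b D = D' at h2 ⊢
    calc s = s * (D' * D ^ (Fintype.card K - 1)) ^ j := by rw [h2, one_pow, mul_one]
      _ = _ := by rw [hq]; ring
  rw [h3]
  exact hlin _ _ (hpoly _)

/-! ### Invariants of the rational points -/

theorem natCard_torusPoints : Nat.card (torusPoints b K) = Fintype.card K ^ n - 1 := by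
  have : Module.Finite K E := Module.Finite.of_basis b
  have : Finite E := Module.finite_of_finite K
  cases nonempty_fintype E
  rw [← Nat.card_congr (unitsEquivRationalPoints b).toEquiv, Nat.card_units,
    Nat.card_eq_fintype_card, Module.card_fintype b, Fintype.card_fin]

theorem finite_torusPoints : Finite (torusPoints b K) := by
  have : Module.Finite K E := Module.Finite.of_basis b
  have : Finite E := Module.finite_of_finite K
  exact Finite.of_equiv _ (unitsEquivRationalPoints b).toEquiv

theorem natCast_card_torusPoints [Fintype (torusPoints b K)] (A : Type*) [CommRing A]
    [Algebra K A] : (Fintype.card (torusPoints b K) : A) = -1 := by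
  have : Nonempty (Fin n) := b.index_nonempty
  have hn : n ≠ 0 := (Fin.pos_iff_nonempty.2 this).ne'
  have hK : (Fintype.card (torusPoints b K) : K) = -1 := by
    rw [← Nat.card_eq_fintype_card, natCard_torusPoints,
      Nat.cast_sub (Nat.one_le_pow _ _ Fintype.card_pos), Nat.cast_pow,
      FiniteField.cast_card_eq_zero, zero_pow hn]
    simp
  rw [← map_natCast (algebraMap K A), hK, map_neg, map_one]

/-- The sum of the conjugates of a monomial of degree less than `n (q - 1)` is the negative of its
value at the origin. Including the origin, it is a sum over all of `K ^ n` of a polynomial of degree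
less than `n (q - 1)` in the coordinates of the group element. -/
theorem sum_smul_prod_torusX_pow [Fintype (torusPoints b K)] (m : Fin n → ℕ)
    (hm : ∑ k, m k < (Fintype.card K - 1) * n) :
    ∑ g : torusPoints b K, g • ∏ k, torusX b k ^ m k = - ∏ k, (0 : coordRing b) ^ m k := by
  classical
  have : Module.Finite K E := Module.Finite.of_basis b
  have : Finite E := Module.finite_of_finite K
  cases nonempty_fintype E
  let P : MvPolynomial (Fin n) (coordRing b) :=
    ∏ k, (∑ l, MvPolynomial.C ((universalPoint b).1.1 k l) * MvPolynomial.X l) ^ m k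
  have heval : ∀ v : Fin n → K, MvPolynomial.eval (fun k => algebraMap K (coordRing b) (v k)) P =
      ∏ k, (∑ l, (universalPoint b).1.1 k l * algebraMap K _ (v l)) ^ m k := by
    intro v
    simp [P]
  have hdeg : P.totalDegree < (Fintype.card K - 1) * Fintype.card (Fin n) := by
    rw [Fintype.card_fin]
    refine lt_of_le_of_lt ((MvPolynomial.totalDegree_finsetProd _ _).trans ?_) hm
    refine Finset.sum_le_sum fun k _ => (MvPolynomial.totalDegree_pow _ _).trans ?_
    refine (Nat.mul_le_mul_left _ (MvPolynomial.IsHomogeneous.totalDegree_le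
      (MvPolynomial.IsHomogeneous.sum _ _ 1 fun l _ =>
        MvPolynomial.isHomogeneous_C_mul_X _ l))).trans (mul_one _).le
  -- split the sum over `K ^ n = E` into the origin and the units of `E`
  have h0 := MvPolynomial.sum_eval_algebraMap_eq_zero (K := K) P hdeg
  rw [← b.equivFun.toEquiv.sum_comp, ← Finset.add_sum_erase _ _ (Finset.mem_univ (0 : E))] at h0
  have hzero : MvPolynomial.eval (fun k => algebraMap K (coordRing b)
      (b.equivFun.toEquiv (0 : E) k)) P = ∏ k, (0 : coordRing b) ^ m k := by
    rw [heval]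
    simp
  have hunits : ∑ g : torusPoints b K, g • ∏ k, torusX b k ^ m k =
      ∑ e ∈ Finset.univ.erase (0 : E),
        MvPolynomial.eval (fun k => algebraMap K (coordRing b) (b.equivFun.toEquiv e k)) P := by
    rw [← (unitsEquivRationalPoints b).toEquiv.sum_comp]
    refine Finset.sum_bij (fun e _ => (e : E)) (fun e _ => by simp)
      (fun e _ e' _ h => Units.ext h)
      (fun e he => ⟨Units.mk0 e (Finset.ne_of_mem_erase he), Finset.mem_univ _, rfl⟩)
      fun e _ => ?_
    rw [heval, Finset.smul_prod']
    refine Finset.prod_congr rfl fun k _ => ?_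
    rw [smul_pow', smul_torusX]
    change (∑ l, _ * algebraMap K _ (torusCoords b (unitsEquivRationalPoints b e).1.1 l)) ^ _ = _
    rw [torusCoords_unitsEquivRationalPoints]
    rfl
  rw [hzero] at h0
  rw [hunits]
  exact eq_neg_of_add_eq_zero_right h0

/-- The trace of an arbitrary function lies in the image of the comorphism of the Lang map. -/
theorem sum_smul_mem_langComorphism_range [Fintype (torusPoints b K)] (s : coordRing b) :
    ∑ g : torusPoints b K, g • s ∈ (langComorphism b).range := by
  have hs : s ∈ Submodule.span (langComorphism b).range (lowMonomials b) :=
    span_lowMonomials b ▸ Submodule.mem_top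
  induction hs using Submodule.span_induction with
  | mem s hs =>
    obtain ⟨m, hm, rfl⟩ := hs
    rw [sum_smul_prod_torusX_pow b m hm]
    exact neg_mem (prod_mem fun k _ => pow_mem (zero_mem _) _)
  | zero => simp
  | add s t _ _ hs ht =>
    simp only [smul_add, Finset.sum_add_distrib]
    exact add_mem hs ht
  | smul r s _ hs =>
    obtain ⟨_, f, rfl⟩ := r
    have : ∀ g : torusPoints b K, g • (langComorphism b f * s) = langComorphism b f * g • s :=
      fun g => by rw [smul_mul', smul_langComorphism]
    change ∑ g : torusPoints b K, g • (langComorphism b f * s) ∈ _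
    simp only [this, ← Finset.mul_sum]
    exact mul_mem ⟨f, rfl⟩ hs

/-- The Lang map of the torus is a Galois covering with group the rational points. -/
theorem isGaloisExtension_langComorphism :
    IsGaloisExtension (torusPoints b K) (langComorphism b).range (coordRing b) where
  injective := Subtype.val_injective
  invariant s := by
    constructor
    · intro hs
      have := finite_torusPoints b
      cases nonempty_fintype (torusPoints b K)
      have h1 := sum_smul_mem_langComorphism_range b s
      rw [Finset.sum_congr rfl fun g _ => hs g, Finset.sum_const, Finset.card_univ,
        nsmul_eq_mul, natCast_card_torusPoints b (coordRing b)] at h1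
      exact ⟨⟨s, neg_mem_iff.1 (neg_one_mul s ▸ h1)⟩, rfl⟩
    · rintro ⟨⟨_, f, rfl⟩, rfl⟩ σ
      exact smul_langComorphism b σ f
  unramified I hI g hg := by
    by_contra hcon
    push Not at hcon
    -- the entries of `U g - U = U (g - 1)` all lie in `I`, and this matrix is invertible
    let N : Matrix (Fin n) (Fin n) (coordRing b) :=
      (universalPoint b).1.1 * (g.1.1 - 1).map (algebraMap K _)
    have hN : ∀ i j, N i j ∈ I := by
      intro i j
      have h1 := congrArg (fun X : torusPoints b (coordRing b) => X.1.1 i j)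
        (torusPointsMap_torusActionHom b g)
      have h2 : N i j = g • (universalPoint b).1.1 i j - (universalPoint b).1.1 i j := by
        have h3 : N = (universalPoint b).1.1 * (g.1.1).map (algebraMap K _) -
            (universalPoint b).1.1 := by
          have h4 : (g.1.1 - 1).map (algebraMap K (coordRing b)) =
              (g.1.1).map (algebraMap K _) - 1 := by
            ext i j
            simp [Matrix.one_apply, apply_ite]
          simp only [N, h4, mul_sub, mul_one]
        rw [h3, Matrix.sub_apply]
        exact congrArg (· - _) h1.symm
      rw [h2]
      exact hcon _
    have hdet : N.det ∈ I := by
      have : Nonempty (Fin n) := b.index_nonempty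
      rw [← Ideal.Quotient.eq_zero_iff_mem, RingHom.map_det]
      have : (Ideal.Quotient.mk I).mapMatrix N = 0 := by
        ext i j
        exact Ideal.Quotient.eq_zero_iff_mem.2 (hN i j)
      rw [this, Matrix.det_zero]
    refine hI.ne_top (Ideal.eq_top_of_isUnit_mem _ hdet ?_)
    rw [Matrix.det_mul]
    refine (isUnit_det_torusPoints b (universalPoint b)).mul ?_
    have h1 : ((g.1.1 - 1).map (algebraMap K (coordRing b))).det =
        algebraMap K _ (g.1.1 - 1).det := (RingHom.map_det _ _).symm
    rw [h1]
    refine IsUnit.map _ ?_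
    obtain ⟨e, rfl⟩ := (unitsEquivRationalPoints b).surjective g
    rw [unitsEquivRationalPoints_coe, ← map_one (Algebra.leftMulMatrix b), ← map_sub]
    refine isUnit_det_leftMulMatrix b (sub_ne_zero.2 fun he => hg ?_)
    exact (congrArg _ (Units.ext he : e = 1)).trans (map_one _)

end Finite

/-! ### Injectivity of the Lang comorphism -/

/-- Algebraicity descends from a subalgebra `B` to a smaller one over which the elements of `B`
are fractions. -/
theorem Algebra.IsAlgebraic.of_le_of_mul_mem {R S : Type*} [CommRing R] [CommRing S] [Algebra R S]
    [IsDomain S] {A B : Subalgebra R S} (hle : A ≤ B) [Algebra.IsAlgebraic B S]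
    (h : ∀ x ∈ B, ∃ a ∈ A, a ≠ 0 ∧ x * a ∈ A) : Algebra.IsAlgebraic A S := by
  let _ : Algebra A B := (Subalgebra.inclusion hle).toAlgebra
  have : IsScalarTower A B S := IsScalarTower.of_algebraMap_eq fun _ => rfl
  have : Algebra.IsAlgebraic A B := by
    constructor
    rintro ⟨x, hx⟩
    obtain ⟨a, ha, ha0, hxa⟩ := h x hx
    let p : Polynomial A := Polynomial.C ⟨a, ha⟩ * Polynomial.X - Polynomial.C ⟨_, hxa⟩
    refine ⟨p, fun hp => ?_, ?_⟩
    · have h1 : p.coeff 1 = 0 := by rw [hp, Polynomial.coeff_zero]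
      simp only [p, Polynomial.coeff_sub, Polynomial.coeff_C_mul, Polynomial.coeff_X_one, mul_one,
        Polynomial.coeff_C_succ, sub_zero] at h1
      exact ha0 (congrArg Subtype.val h1)
    · simp only [p, map_sub, map_mul, Polynomial.aeval_C, Polynomial.aeval_X]
      exact Subtype.ext (sub_eq_zero.2 (mul_comm _ _))
  exact Algebra.IsAlgebraic.trans A B S

section Injective

theorem isDomain_coordRing : IsDomain (coordRing b) :=
  have : IsDomain (Localization.Away (genericMatrix b).det) :=
    IsLocalization.isDomain_localization
      (powers_le_nonZeroDivisors_of_noZeroDivisors (det_genericMatrix_ne_zero b))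
  (coordRingEquiv b).symm.toMulEquiv.isDomain _

theorem algebraicIndependent_torusX : AlgebraicIndependent K (torusX b) :=
  aeval_torusX_injective b

variable [Fintype K]

theorem finite_lowMonomials : (lowMonomials b).Finite := by
  refine ((Set.finite_Iic (fun _ : Fin n => (Fintype.card K - 1) * n)).image
    fun m => ∏ k, torusX b k ^ m k).subset ?_
  rintro _ ⟨m, hm, rfl⟩
  exact ⟨m, fun k => (Finset.single_le_sum (fun _ _ => Nat.zero_le _) (Finset.mem_univ k)).trans
    hm.le, rfl⟩

theorem finite_langComorphism_range : Module.Finite (langComorphism b).range (coordRing b) :=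
  ⟨⟨(finite_lowMonomials b).toFinset, by rw [Set.Finite.coe_toFinset, span_lowMonomials]⟩⟩

/-- The images of the coordinates under the Lang comorphism are algebraically independent: the
coordinate ring, of transcendence degree `n`, is algebraic over the `n` elements. -/
theorem algebraicIndependent_langComorphism_torusX :
    AlgebraicIndependent K fun k => langComorphism b (torusX b k) := by
  have := isDomain_coordRing b
  have := finite_langComorphism_range b
  set y := fun k => langComorphism b (torusX b k) with hy
  have hle : Algebra.adjoin K (Set.range y) ≤ (langComorphism b).range :=
    Algebra.adjoin_le (by rintro _ ⟨k, rfl⟩; exact ⟨_, rfl⟩)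
  have hmem : ∀ f : MvPolynomial (Fin n) K, langComorphism b (MvPolynomial.aeval (torusX b) f) ∈
      Algebra.adjoin K (Set.range y) := by
    intro f
    rw [← AlgHom.comp_apply, MvPolynomial.comp_aeval, Algebra.adjoin_range_eq_range_aeval]
    exact ⟨f, rfl⟩
  have : Algebra.IsAlgebraic (Algebra.adjoin K (Set.range y)) (coordRing b) := by
    refine Algebra.IsAlgebraic.of_le_of_mul_mem hle ?_
    rintro _ ⟨s, rfl⟩
    obtain ⟨j, f, hf⟩ := exists_mul_det_pow_eq_aeval b s
    refine ⟨langComorphism b ((universalPoint b).1.1.det ^ j), ?_, ?_, ?_⟩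
    · rw [det_universalPoint, ← map_pow (MvPolynomial.aeval (torusX b))]
      exact hmem _
    · exact (((isUnit_det_torusPoints b (universalPoint b)).pow j).map
        (langComorphism b)).ne_zero
    · have h := hmem f
      rw [← hf, map_mul] at h
      exact h
  have : FaithfulSMul K (coordRing b) := (faithfulSMul_iff_algebraMap_injective K (coordRing b)).2
    (algebraicIndependent_torusX b).algebraMap_injective
  exact (Algebra.IsAlgebraic.isTranscendenceBasis_of_lift_le_trdeg_of_finite K y
    (algebraicIndependent_torusX b).lift_cardinalMk_le_trdeg).1

theorem langComorphism_injective : Function.Injective (langComorphism b) := by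
  rw [injective_iff_map_eq_zero]
  intro s hs
  obtain ⟨j, f, hf⟩ := exists_mul_det_pow_eq_aeval b s
  have h := congrArg (langComorphism b) hf
  rw [map_mul, hs, zero_mul, ← AlgHom.comp_apply, MvPolynomial.comp_aeval] at h
  have hf0 : f = 0 := (map_eq_zero_iff _
    (algebraicIndependent_langComorphism_torusX b)).1 h.symm
  rw [hf0, map_zero] at hf
  exact ((isUnit_det_torusPoints b (universalPoint b)).pow j).mul_left_eq_zero.1 hf

theorem isLocalizedPolynomialRing_langComorphism_range :
    IsLocalizedPolynomialRing K (langComorphism b).range :=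
  ⟨n, _, det_genericMatrix_ne_zero b,
    ⟨(coordRingEquiv b).trans (AlgEquiv.ofInjective _ (langComorphism_injective b))⟩⟩

end Injective

/-! ### Genericity of the Lang covering -/

theorem torusPointsMap_unitsEquivTorusPoints {A B : Type*} [CommRing A] [Algebra K A] [CommRing B]
    [Algebra K B] (f : A →ₐ[K] B) (z : (A ⊗[K] E)ˣ) :
    torusPointsMap b f (unitsEquivTorusPoints b A z) =
      unitsEquivTorusPoints b B
        (Units.map (Algebra.TensorProduct.map f (AlgHom.id K E)).toMonoidHom z) :=
  torusPoints_ext b (leftMulMatrix_baseChange_map b f z)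

theorem unitsEquivTorusPoints_includeRight {A : Type*} [CommRing A] [Algebra K A] (e : Eˣ) :
    unitsEquivTorusPoints b A
        (Units.map (Algebra.TensorProduct.includeRight : E →ₐ[K] A ⊗[K] E).toMonoidHom e) =
      torusPointsMap b (Algebra.ofId K A) (unitsEquivRationalPoints b e) := by
  change _ = torusPointsMap b _ (unitsEquivTorusPoints b K _)
  rw [torusPointsMap_unitsEquivTorusPoints]
  congr 1
  ext
  change (1 : A) ⊗ₜ[K] (e : E) = Algebra.ofId K A 1 ⊗ₜ[K] (e : E)
  rw [map_one]

variable [Fintype K]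

/-- Every Galois algebra `M` with group the rational points of the torus comes from a point of the
torus over `M` on which the Galois action is multiplication by rational points. This is Hilbert's
Theorem 90 for the Galois extension `M ⊗ E` of the Artinian ring `L ⊗ E`. -/
theorem exists_torusPoint_of_isGaloisExtension {L M : Type*} [Field L] [Algebra K L] [CommRing M]
    [Algebra L M] [Algebra K M] [IsScalarTower K L M] [MulSemiringAction (torusPoints b K) M]
    [SMulCommClass (torusPoints b K) K M] (hM : IsGaloisExtension (torusPoints b K) L M) :
    ∃ X : torusPoints b M, ∀ g : torusPoints b K,
      torusPointsMap b (MulSemiringAction.toAlgHom K M g) X =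
        X * torusPointsMap b (Algebra.ofId K M) g := by
  have := finite_torusPoints b
  cases nonempty_fintype (torusPoints b K)
  have : Module.Finite K E := Module.Finite.of_basis b
  let act : torusPoints b K →* ((M ⊗[K] E) →ₐ[K] (M ⊗[K] E)) :=
    { toFun := fun g => Algebra.TensorProduct.map (MulSemiringAction.toAlgHom K M g)
        (AlgHom.id K E)
      map_one' := by
        ext <;> simp
      map_mul' := fun g h => by
        ext <;> simp [mul_smul] }
  let _ : MulSemiringAction (torusPoints b K) (M ⊗[K] E) :=
    { smul := fun g z => act g z
      one_smul := fun z => by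
        change act 1 z = z
        rw [map_one]
        rfl
      mul_smul := fun g h z => by
        change act (g * h) z = act g (act h z)
        rw [map_mul]
        rfl
      smul_zero := fun g => map_zero (act g)
      smul_add := fun g => map_add (act g)
      smul_one := fun g => map_one (act g)
      smul_mul := fun g => map_mul (act g) }
  have hact : ∀ (g : torusPoints b K) (z : M ⊗[K] E), g • z = act g z := fun _ _ => rfl
  let base : (L ⊗[K] E) →ₐ[K] (M ⊗[K] E) :=
    Algebra.TensorProduct.map (IsScalarTower.toAlgHom K L M) (AlgHom.id K E)
  let _ : Algebra (L ⊗[K] E) (M ⊗[K] E) := base.toRingHom.toAlgebra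
  have hbase : ∀ a, algebraMap (L ⊗[K] E) (M ⊗[K] E) a = base a := fun _ => rfl
  have hcard : IsUnit (Fintype.card (torusPoints b K) : L ⊗[K] E) := by
    rw [natCast_card_torusPoints b]
    exact isUnit_one.neg
  have hN : IsGaloisExtension (torusPoints b K) (L ⊗[K] E) (M ⊗[K] E) := by
    refine hM.of_span_eq_top hcard ?_ ?_
      (Algebra.TensorProduct.includeLeft : M →ₐ[K] M ⊗[K] E).toRingHom ?_ ?_ ?_
    · exact Module.Flat.rTensor_preserves_injective_linearMap
        (IsScalarTower.toAlgHom K L M).toLinearMap hM.injective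
    · intro g a
      rw [hact, hbase, ← AlgHom.comp_apply]
      congr 1
      ext x
      · simp [act, base, hM.smul_algebraMap]
      · simp [act, base]
    · intro g s
      rw [hact]
      simp [act]
    · intro r
      exact ⟨r ⊗ₜ 1, by rw [hbase]; simp [base]⟩
    · refine eq_top_iff.2 fun z _ => ?_
      induction z using TensorProduct.induction_on with
      | zero => exact zero_mem _
      | add x y hx hy => exact add_mem (hx trivial) (hy trivial)
      | tmul m e =>
        have h1 : m ⊗ₜ[K] e = ((1 : L) ⊗ₜ[K] e) • (m ⊗ₜ[K] (1 : E)) := by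
          rw [Algebra.smul_def, hbase]
          simp [base]
        rw [h1]
        exact Submodule.smul_mem _ _ (Submodule.subset_span ⟨m, rfl⟩)
  have : IsArtinianRing (L ⊗[K] E) := IsArtinianRing.of_finite L _
  let c : torusPoints b K →* (L ⊗[K] E)ˣ :=
    (Units.map (Algebra.TensorProduct.includeRight : E →ₐ[K] L ⊗[K] E).toMonoidHom).comp
      (unitsEquivRationalPoints b).symm.toMonoidHom
  obtain ⟨X, hX⟩ := hN.exists_unit_smul_eq hcard c
  refine ⟨unitsEquivTorusPoints b M X, fun g => ?_⟩
  obtain ⟨e, rfl⟩ := (unitsEquivRationalPoints b).surjective g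
  rw [torusPointsMap_unitsEquivTorusPoints, ← unitsEquivTorusPoints_includeRight, ← map_mul]
  congr 1
  apply Units.ext
  refine (hX (unitsEquivRationalPoints b e)).trans ?_
  rw [Units.val_mul]
  congr 1
  change base ((1 : L) ⊗ₜ ((unitsEquivRationalPoints b).symm (unitsEquivRationalPoints b e) : Eˣ).1)
    = (1 : M) ⊗ₜ[K] (e : E)
  rw [MulEquiv.symm_apply_apply]
  simp [base]

/-- The Lang covering of the torus is a generic extension. -/
theorem isGenericExtension_langComorphism :
    IsGenericExtension.{u, v} K (torusPoints b K) (langComorphism b).range (coordRing b) := by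
  have := finite_torusPoints b
  refine IsGenericExtension.of_equivariant (isGaloisExtension_langComorphism b)
    (isLocalizedPolynomialRing_langComorphism_range b) fun L _ _ M _ _ _ hM => ?_
  let _ : Algebra K M := ((algebraMap L M).comp (algebraMap K L)).toAlgebra
  have : IsScalarTower K L M := IsScalarTower.of_algebraMap_eq fun _ => rfl
  have : SMulCommClass (torusPoints b K) K M := ⟨fun g k m => by
    rw [Algebra.smul_def, smul_mul', Algebra.smul_def, IsScalarTower.algebraMap_apply K L M,
      hM.smul_algebraMap]⟩
  obtain ⟨X, hX⟩ := exists_torusPoint_of_isGaloisExtension b hM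
  refine ⟨(coordRingEval b X).toRingHom, fun k => (coordRingEval b X).commutes k, fun g s => ?_⟩
  have h : (coordRingEval b X).comp (torusActionHom b g) =
      (MulSemiringAction.toAlgHom K M g).comp (coordRingEval b X) := by
    apply coordRing_hom_ext
    refine (congrArg (torusPointsMap b (coordRingEval b X))
      (torusPointsMap_torusActionHom b g)).trans ?_
    refine Eq.trans ?_ ((hX g).symm.trans (congrArg
      (torusPointsMap b (MulSemiringAction.toAlgHom K M g))
      (torusPointsMap_coordRingEval b X).symm))
    rw [map_mul, torusPointsMap_coordRingEval]
    exact congrArg (X * torusPointsMap b · g) (Subsingleton.elim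
      ((coordRingEval b X).comp (Algebra.ofId K _)) (Algebra.ofId K M))
  exact DFunLike.congr_fun h s

end Torus

/-! ### Base change of generic extensions -/

/-- A localized polynomial ring over `K` becomes one over an extension field after base change. -/
theorem IsLocalizedPolynomialRing.baseChange {K R : Type*} [Field K] [CommRing R] [Algebra K R]
    (h : IsLocalizedPolynomialRing K R) (F : Type*) [Field F] [Algebra K F] :
    IsLocalizedPolynomialRing F (F ⊗[K] R) := by
  obtain ⟨d, g, hg, ⟨e⟩⟩ := h
  let g' : MvPolynomial (Fin d) F := MvPolynomial.map (algebraMap K F) g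
  have hg' : g' ≠ 0 := by
    rwa [ne_eq, map_eq_zero_iff _ (MvPolynomial.map_injective _ (algebraMap K F).injective)]
  let T := Localization.Away g
  let T' := Localization.Away g'
  let toT : MvPolynomial (Fin d) K →ₐ[K] T := IsScalarTower.toAlgHom K _ _
  let toT' : MvPolynomial (Fin d) F →ₐ[F] T' := IsScalarTower.toAlgHom F _ _
  let a : MvPolynomial (Fin d) F →ₐ[F] F ⊗[K] T :=
    MvPolynomial.aeval fun i => 1 ⊗ₜ toT (MvPolynomial.X i)
  have ha : ∀ f : MvPolynomial (Fin d) K,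
      a (MvPolynomial.map (algebraMap K F) f) = 1 ⊗ₜ toT f := by
    intro f
    have h1 : (a.restrictScalars K).comp (MvPolynomial.mapAlgHom (Algebra.ofId K F)) =
        (Algebra.TensorProduct.includeRight : T →ₐ[K] F ⊗[K] T).comp toT := by
      ext i
      simp [a]
    exact DFunLike.congr_fun h1 f
  have hau : ∀ y : Submonoid.powers g', IsUnit (a y) := by
    rintro ⟨_, m, rfl⟩
    rw [map_pow, ha]
    exact ((IsLocalization.Away.algebraMap_isUnit g).map
      (Algebra.TensorProduct.includeRight : T →ₐ[K] F ⊗[K] T)).pow m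
  -- `φ` and `ψ` both send each variable to itself, and are thus mutually inverse
  let φ : T' →ₐ[F] F ⊗[K] T := IsLocalization.liftAlgHom (M := Submonoid.powers g') hau
  have hφ : ∀ f, φ (toT' f) = a f := fun f => IsLocalization.lift_eq _ _
  let c : MvPolynomial (Fin d) K →ₐ[K] T' :=
    (toT'.restrictScalars K).comp (MvPolynomial.mapAlgHom (Algebra.ofId K F))
  have hcu : ∀ y : Submonoid.powers g, IsUnit (c y) := by
    rintro ⟨_, m, rfl⟩
    rw [map_pow]
    exact (IsLocalization.Away.algebraMap_isUnit g').pow m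
  let c' : T →ₐ[K] T' := IsLocalization.liftAlgHom (M := Submonoid.powers g) hcu
  have hc' : ∀ f, c' (toT f) = c f := fun f => IsLocalization.lift_eq _ _
  let ψ : F ⊗[K] T →ₐ[F] T' :=
    Algebra.TensorProduct.lift (Algebra.ofId F T') c' fun _ _ => Commute.all _ _
  have hψ : ∀ t, ψ (1 ⊗ₜ t) = c' t := fun t => by simp [ψ]
  have h1 : φ.comp ψ = AlgHom.id F _ := by
    apply Algebra.TensorProduct.ext_ring
    refine IsLocalization.algHom_ext (Submonoid.powers g) ?_
    ext i
    change φ (ψ (1 ⊗ₜ toT (MvPolynomial.X i))) = 1 ⊗ₜ toT (MvPolynomial.X i)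
    rw [hψ, hc']
    change φ (toT' (MvPolynomial.map (algebraMap K F) _)) = _
    rw [hφ, ha]
  have h2 : ψ.comp φ = AlgHom.id F _ := by
    refine IsLocalization.algHom_ext (Submonoid.powers g') ?_
    ext i
    change ψ (φ (toT' (MvPolynomial.X i))) = toT' (MvPolynomial.X i)
    rw [hφ, ← MvPolynomial.map_X (algebraMap K F) i, ha, hψ, hc']
    rfl
  exact ⟨d, g', hg', ⟨(AlgEquiv.ofAlgHom φ ψ h1 h2).trans
    (Algebra.TensorProduct.congr AlgEquiv.refl e)⟩⟩

/-- A generic extension stays generic when the group acts through an isomorphism. -/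
theorem IsGenericExtension.of_mulEquiv {K G H R S : Type*} [Field K] [Group G] [Group H]
    [CommRing R] [CommRing S] [Algebra K R] [Algebra R S] [MulSemiringAction G S]
    [MulSemiringAction H S] (h : IsGenericExtension.{u, v} K G R S) (e : H ≃* G)
    (he : ∀ (τ : H) (s : S), τ • s = e τ • s) : IsGenericExtension.{u, v} K H R S where
  isGalois := h.isGalois.of_mulEquiv e he
  isLocalized := h.isLocalized
  generic L _ _ M _ _ _ hM := by
    let _ : MulSemiringAction G M := MulSemiringAction.compHom M e.symm.toMonoidHom
    have hG : ∀ (σ : G) (m : M), σ • m = e.symm σ • m := fun _ _ => rfl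
    obtain ⟨φ, f, hf⟩ := h.generic L M (hM.of_mulEquiv e.symm hG)
    refine ⟨φ, f, fun τ a s => ?_⟩
    rw [he, hf, hG, e.symm_apply_apply]

/-- The base change of a generic extension to an extension field is generic, provided that the
group order is invertible. -/
theorem IsGenericExtension.baseChange {K G R S : Type*} [Field K] [Group G] [Fintype G]
    [CommRing R] [CommRing S] [Algebra K R] [Algebra R S] [Algebra K S] [IsScalarTower K R S]
    [MulSemiringAction G S] (h : IsGenericExtension.{u, v} K G R S)
    (hcard : IsUnit (Fintype.card G : K)) (F : Type*) [Field F] [Algebra K F] :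
    ∃ (_ : Algebra (F ⊗[K] R) (F ⊗[K] S)) (_ : MulSemiringAction G (F ⊗[K] S)),
      IsGenericExtension.{u, v} F G (F ⊗[K] R) (F ⊗[K] S) := by
  have : SMulCommClass G K S := ⟨fun g k s => by
    rw [Algebra.smul_def, smul_mul', Algebra.smul_def, IsScalarTower.algebraMap_apply K R S,
      h.isGalois.smul_algebraMap]⟩
  let act : G →* ((F ⊗[K] S) →ₐ[F] (F ⊗[K] S)) :=
    { toFun := fun g => Algebra.TensorProduct.map (AlgHom.id F F)
        (MulSemiringAction.toAlgHom K S g)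
      map_one' := by
        ext; simp
      map_mul' := fun g h => by
        ext; simp [mul_smul] }
  let actS : MulSemiringAction G (F ⊗[K] S) :=
    { smul := fun g z => act g z
      one_smul := fun z => by
        change act 1 z = z
        rw [map_one]
        rfl
      mul_smul := fun g h z => by
        change act (g * h) z = act g (act h z)
        rw [map_mul]
        rfl
      smul_zero := fun g => map_zero (act g)
      smul_add := fun g => map_add (act g)
      smul_one := fun g => map_one (act g)
      smul_mul := fun g => map_mul (act g) }
  have hact : ∀ (g : G) (z : F ⊗[K] S), g • z = act g z := fun _ _ => rfl
  let base : (F ⊗[K] R) →ₐ[F] (F ⊗[K] S) :=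
    Algebra.TensorProduct.map (AlgHom.id F F) (IsScalarTower.toAlgHom K R S)
  let algS : Algebra (F ⊗[K] R) (F ⊗[K] S) := base.toRingHom.toAlgebra
  have hbase : ∀ a, algebraMap (F ⊗[K] R) (F ⊗[K] S) a = base a := fun _ => rfl
  refine ⟨algS, actS, IsGenericExtension.of_equivariant ?_ (h.isLocalized.baseChange F) ?_⟩
  · refine h.isGalois.of_span_eq_top ?_ ?_ ?_
      (Algebra.TensorProduct.includeRight : S →ₐ[K] F ⊗[K] S).toRingHom ?_ ?_ ?_
    · rw [← map_natCast (algebraMap K (F ⊗[K] R))]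
      exact hcard.map _
    · exact Module.Flat.lTensor_preserves_injective_linearMap
        (IsScalarTower.toAlgHom K R S).toLinearMap h.isGalois.injective
    · intro g a
      rw [hact, hbase, ← AlgHom.comp_apply]
      congr 1
      ext x
      simp [act, base, h.isGalois.smul_algebraMap]
    · intro g s
      rw [hact]
      simp [act]
    · intro r
      exact ⟨1 ⊗ₜ r, by rw [hbase]; simp [base]⟩
    · refine eq_top_iff.2 fun z _ => ?_
      induction z using TensorProduct.induction_on with
      | zero => exact zero_mem _
      | add x y hx hy => exact add_mem (hx trivial) (hy trivial)
      | tmul a s =>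
        have h1 : a ⊗ₜ[K] s = (a ⊗ₜ[K] (1 : R)) • ((1 : F) ⊗ₜ[K] s) := by
          rw [Algebra.smul_def, hbase]
          simp [base]
        rw [h1]
        exact Submodule.smul_mem _ _ (Submodule.subset_span ⟨s, rfl⟩)
  · intro L _ _ M _ _ _ hM
    let _ : Algebra K L := ((algebraMap F L).comp (algebraMap K F)).toAlgebra
    have : IsScalarTower K F L := IsScalarTower.of_algebraMap_eq fun _ => rfl
    obtain ⟨φ, hφ⟩ := h.generic L M hM
    let _ : Algebra R L := φ.toRingHom.toAlgebra
    have : IsScalarTower K R L := IsScalarTower.of_algebraMap_eq fun k => (φ.commutes k).symm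
    obtain ⟨e, he⟩ := hφ
    let _ : Algebra F M := ((algebraMap L M).comp (algebraMap F L)).toAlgebra
    have : IsScalarTower F L M := IsScalarTower.of_algebraMap_eq fun _ => rfl
    let _ : Algebra K M := ((algebraMap L M).comp (algebraMap K L)).toAlgebra
    have : IsScalarTower K L M := IsScalarTower.of_algebraMap_eq fun _ => rfl
    have : IsScalarTower K F M := IsScalarTower.of_algebraMap_eq fun _ => rfl
    let ψ₀ : S →ₐ[K] M :=
      { toRingHom := e.toRingEquiv.toRingHom.comp
          (Algebra.TensorProduct.includeRight : S →ₐ[R] L ⊗[R] S).toRingHom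
        commutes' := fun k => by
          change e ((1 : L) ⊗ₜ[R] algebraMap K S k) = algebraMap L M (algebraMap K L k)
          rw [← e.commutes, IsScalarTower.algebraMap_apply K R S,
            IsScalarTower.algebraMap_apply K R L, Algebra.TensorProduct.algebraMap_apply,
            Algebra.algebraMap_self_apply, Algebra.TensorProduct.tmul_one_eq_one_tmul] }
    have hψ₀ : ∀ s, ψ₀ s = e ((1 : L) ⊗ₜ[R] s) := fun _ => rfl
    let ψ : F ⊗[K] S →ₐ[F] M :=
      Algebra.TensorProduct.lift (Algebra.ofId F M) ψ₀ fun _ _ => Commute.all _ _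
    have hψ : ∀ a s, ψ (a ⊗ₜ s) = algebraMap L M (algebraMap F L a) * ψ₀ s := fun a s =>
      Algebra.TensorProduct.lift_tmul _ _ _ _ _
    refine ⟨ψ.toRingHom, fun k => ?_, fun g s => ?_⟩
    · change ψ (base (algebraMap F _ k)) = _
      rw [base.commutes, ψ.commutes]
      rfl
    · change ψ (act g s) = g • ψ s
      induction s using TensorProduct.induction_on with
      | zero => simp
      | add x y hx hy => rw [map_add, map_add, hx, hy, map_add, smul_add]
      | tmul a s =>
        change ψ (a ⊗ₜ (g • s)) = _
        rw [hψ, hψ, smul_mul', hM.smul_algebraMap, hψ₀, hψ₀, he]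

/-! ### Tori over prime fields -/

theorem nonempty_torusPoints_mulEquiv (p : ℕ) [Fact p.Prime] {n : ℕ}
    (b : Module.Basis (Fin n) (ZMod p) (GaloisField p n)) :
    Nonempty (torusPoints b (ZMod p) ≃* Multiplicative (ZMod (p ^ n - 1))) := by
  have : IsCyclic (torusPoints b (ZMod p)) :=
    isCyclic_of_surjective (unitsEquivRationalPoints b) (unitsEquivRationalPoints b).surjective
  have hcard : Nat.card (torusPoints b (ZMod p)) = p ^ n - 1 := by
    rw [natCard_torusPoints, ZMod.card]
  exact ⟨(hcard ▸ zmodCyclicMulEquiv this).symm⟩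

theorem hasGenericExtension_of_charP (p : ℕ) [Fact p.Prime] {n : ℕ} (hn : n ≠ 0)
    (F : Type w) [Field F] [CharP F p] :
    HasGenericExtension.{u, v, w} F (Multiplicative (ZMod (p ^ n - 1))) := by
  let b : Module.Basis (Fin n) (ZMod p) (GaloisField p n) :=
    Module.finBasisOfFinrankEq _ _ (GaloisField.finrank p hn)
  let _ : Algebra (ZMod p) F := ZMod.algebra F p
  have := finite_torusPoints b
  cases nonempty_fintype (torusPoints b (ZMod p))
  have hcard : IsUnit (Fintype.card (torusPoints b (ZMod p)) : ZMod p) := by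
    rw [natCast_card_torusPoints b]
    exact isUnit_one.neg
  have : IsScalarTower (ZMod p) (langComorphism b).range (coordRing b) :=
    IsScalarTower.of_algebraMap_eq fun _ => rfl
  obtain ⟨algS, actS, h⟩ := (isGenericExtension_langComorphism.{u, v} b).baseChange hcard F
  obtain ⟨e⟩ := nonempty_torusPoints_mulEquiv p b
  let actC : MulSemiringAction (Multiplicative (ZMod (p ^ n - 1))) (F ⊗[ZMod p] coordRing b) :=
    MulSemiringAction.compHom _ e.symm.toMonoidHom
  exact ⟨_, _, _, _, _, algS, actC, h.of_mulEquiv e.symm fun _ _ => rfl⟩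

end

theorem mainTheorem6 (p : ℕ) [Fact p.Prime] (hp : Odd p) (n : ℕ) (hn : 1 ≤ n) :
    -- a generic `C_{p^n - 1}`-extension exists over every field of characteristic `p`
    (∀ (K : Type w) [Field K] [CharP K p],
      HasGenericExtension.{u, v, w} K (Multiplicative (ZMod (p ^ n - 1)))) ∧
    -- over `𝔽_p` it comes from the Lang map of `T = Res_{𝔽_{p^n}/𝔽_p} G_m`
    ∀ b : Module.Basis (Fin n) (ZMod p) (GaloisField p n),
      Nonempty (torusPoints b (ZMod p) ≃* Multiplicative (ZMod (p ^ n - 1))) ∧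
      (genericMatrix b).det ≠ 0 ∧
      (∃ e : Localization.Away (genericMatrix b).det ≃ₐ[ZMod p] coordRing b,
        ∀ i j, (e (algebraMap _ _ (genericMatrix b i j)) : GeomPoints b → AlgebraicClosure (ZMod p))
          = coordFun b i j) ∧
      IsGenericExtension.{u, v} (ZMod p) (torusPoints b (ZMod p))
        (langComorphism b).range (coordRing b) := by
  refine ⟨fun K _ _ => hasGenericExtension_of_charP p (Nat.one_le_iff_ne_zero.1 hn) K, fun b =>
    ⟨nonempty_torusPoints_mulEquiv p b, det_genericMatrix_ne_zero b,
      ⟨coordRingEquiv b, fun i j => ?_⟩, isGenericExtension_langComorphism b⟩⟩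
  rw [coordRingEquiv_algebraMap]
  exact mulMatrix_torusX_apply b i j
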